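/- Notation. For a finitely supported filter $a:\mathbb Z^d\to\mathbb C$ put $\widehat a(\xi)=\sum_{k\in\mathbb Z^d}a(k)e^{-ik\cdot\xi}$. Filters $a,b_1,\dots,b_s$ form a ($d$-dimensional dyadic) tight framelet filter bank if, for all $\xi\in\mathbb R^d$ and $\omega\in\{0,1\}^d$, $$\widehat a(\xi)\overline{\widehat a(\xi+\pi\omega)}+\sum_{\ell=1}^s\widehat{b_\ell}(\xi)\overline{\widehat{b_\ell}(\xi+\pi\omega)}=\begin{cases}1,&\omega=0,\\0,&\omega\neq0.\end{cases}$$ Functions $\phi,\psi_1,\dots,\psi_s\in L_2(\mathbb R^d)$ form a tight framelet in $L_2(\mathbb R^d)$ if, for all $f\in L_2(\mathbb R^d)$, $$\|f\|^2=\sum_{k\in\mathbb Z^d}|\langle f,\phi(\cdot-k)\rangle|^2+\sum_{j=0}^\infty\sum_{\ell=1}^s\sum_{k\in\mathbb Z^d}|\langle f,2^{jd/2}\psi_\ell(2^j\cdot-k)\rangle|^2 .$$ Fourier transforms are normalized by $\widehat f(\xi)=\int f(x)e^{-ix\cdot\xi}\,dx$. Write $\delta_\gamma$ for the sequence equal to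 $1$ at $\gamma$ and $0$ elsewhere. The $n$-dimensional Haar low-pass filter is $a^H=2^{-n}\sum_{\gamma\in\{0,1\}^n}\delta_\gamma$; the Haar high-pass filters $b_1,\dots,b_s$, $s=\binom{2^n}{2}$, are the filters $2^{-n}(\delta_{\gamma_1}-\delta_{\gamma_2})$, one for each unordered pair of distinct points $\gamma_1,\gamma_2\in\{0,1\}^n$ (ordered arbitrarily). For a $d\times n$ integer matrix $P$ and a filter $a$ on $\mathbb Z^n$, the projected filter on $\mathbb Z^d$ is $[Pa](j)=\sum_{k\in\mathbb Z^n,\,Pk=j}a(k)$. The box spline $M_P$ is given by $$\widehat{M_P}(\xi)=\prod_{k}\frac{1-e^{-ik\cdot\xi}}{ik\cdot\xi},$$ where $k$ runs through the columns of $P$ (with multiplicity) and a factor with $k\cdot\xi=0$ is read as $1$. Theorem. Let $P$ be a $d\times n$ integer matrix of rank $d$ with $P^{T}(\mathbb Z^d\setminus 2\mathbb Z^d)\subseteq\mathbb Z^n\setminus 2\mathbb Z^n$, and let $\{a^H;b_1,\dots,b_s\}$ be the $n$-dimensional Haar filter bank above. Then: (1) $\{Pa^H;Pb_1,\dots,Pb_s\}$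 is a $d$-dimensional tight framelet filter bank. (2) $a_P:=Pa^H$ is the box spline refinement filter: $\widehat{a_P}(0)=1$ and $\widehat{M_P}(2\xi)=\widehat{a_P}(\xi)\widehat{M_P}(\xi)$ for all $\xi\in\mathbb R^d$. (3) If $b_\ell=2^{-n}(\delta_{\gamma_1}-\delta_{\gamma_2})$, then $Pb_\ell=0$ when $P\gamma_1=P\gamma_2$, and otherwise $Pb_\ell$ has exactly two nonzero coefficients, which are real, of the same modulus and of opposite signs (the filter is directional). (4) The products $\widehat\phi(\xi):=\prod_{j=1}^\infty\widehat{Pa^H}(2^{-j}\xi)$ converge for all $\xi\in\mathbb R^d$, and there are tempered distributions $\phi,\psi_1,\dots,\psi_s$ with Fourier transforms $\widehat\phi(\xi)$ and $\widehat{\psi_\ell}(\xi)=\widehat{Pb_\ell}(\xi/2)\widehat\phi(\xi/2)$. Any such $\phi$ is the box spline $M_P$, and any such $\phi,\psi_1,\dots,\psi_s$ are compactly supported functions in $L_2(\mathbb R^d)$ that form a tight framelet $\{\phi;\psi_1,\dots,\psi_s\}$ in $L_2(\mathbb R^d)$. -/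

import Mathlib

open MeasureTheory
open scoped FourierTransform SchwartzMap ENNReal ComplexConjugate Matrix

noncomputable section

namespace BoxSpline

/-- The Euclidean space `ℝ^d` (with its Lebesgue measure `volume`). -/
abbrev E (d : ℕ) : Type := EuclideanSpace ℝ (Fin d)

/-- Finitely supported complex filters on `ℤ^d`. -/
abbrev Filt (d : ℕ) : Type := (Fin d → ℤ) →₀ ℂ

/-- The integer vector `k ∈ ℤ^d` as a point of `ℝ^d`. -/
def pt {d : ℕ} (k : Fin d → ℤ) : E d := WithLp.toLp 2 fun i => (k i : ℝ)

/-- The Fourier series `â(ξ) = ∑ₖ a(k) e^{-i k·ξ}` of a filter. -/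
def fourierSeries {d : ℕ} (a : Filt d) (ξ : E d) : ℂ :=
  a.sum fun k c => c * Complex.exp (-(Complex.I * ((inner ℝ (pt k) ξ : ℝ) : ℂ)))

/-- The Dirac sequence `δ_γ` at `γ ∈ ℤ^d`. -/
def dirac {d : ℕ} (γ : Fin d → ℤ) : Filt d := Finsupp.single γ 1

/-- The vertices `{0,1}^d` of the unit cube, inside `ℤ^d`. -/
def cubeVertices (d : ℕ) : Finset (Fin d → ℤ) := Fintype.piFinset fun _ => {0, 1}

/-- `{a; b₁, …, b_s}` is a `d`-dimensional dyadic tight framelet filter bank. -/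
def IsTightFrameletFilterBank {d s : ℕ} (a : Filt d) (b : Fin s → Filt d) : Prop :=
  ∀ ξ : E d, ∀ ω ∈ cubeVertices d,
    fourierSeries a ξ * conj (fourierSeries a (ξ + Real.pi • pt ω)) +
      ∑ l, fourierSeries (b l) ξ * conj (fourierSeries (b l) (ξ + Real.pi • pt ω)) =
    if ω = 0 then 1 else 0

/-- The Haar low-pass filter: `2^{-d}` on `{0,1}^d` and `0` elsewhere. -/
def haarLowPass (d : ℕ) : Filt d := ∑ γ ∈ cubeVertices d, ((2 : ℂ) ^ d)⁻¹ • dirac γ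

/-- The Haar high-pass filter `2^{-d} (δ_{γ₁} - δ_{γ₂})` of an edge `(γ₁, γ₂)`. -/
def haarHighPass {d : ℕ} (e : (Fin d → ℤ) × (Fin d → ℤ)) : Filt d :=
  ((2 : ℂ) ^ d)⁻¹ • (dirac e.1 - dirac e.2)

/-- `e` lists every undirected edge between two different points of `{0,1}^n` exactly once,
in some order and with some choice of the orientation of each edge. -/
structure IsEdgeEnumeration {n s : ℕ} (e : Fin s → (Fin n → ℤ) × (Fin n → ℤ)) : Prop where
  fst_mem : ∀ l, (e l).1 ∈ cubeVertices n
  snd_mem : ∀ l, (e l).2 ∈ cubeVertices n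
  ne : ∀ l, (e l).1 ≠ (e l).2
  existsUnique : ∀ γ₁ ∈ cubeVertices n, ∀ γ₂ ∈ cubeVertices n, γ₁ ≠ γ₂ →
    ∃! l, e l = (γ₁, γ₂) ∨ e l = (γ₂, γ₁)

/-- The projected filter `[P a](j) = ∑_{k ∈ P⁻¹ j} a(k)`. -/
def project {d n : ℕ} (P : Matrix (Fin d) (Fin n) ℤ) (a : Filt n) : Filt d :=
  Finsupp.mapDomain (fun k => P *ᵥ k) a

/-- A filter with exactly two nonzero coefficients, `c` and `-c` with `c > 0`. -/
def IsDirectionalFilter {d : ℕ} (b : Filt d) : Prop :=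
  ∃ (γ₁ γ₂ : Fin d → ℤ) (c : ℝ), γ₁ ≠ γ₂ ∧ 0 < c ∧ b = (c : ℂ) • (dirac γ₁ - dirac γ₂)

/-- The sublattice `2ℤ^d` of `ℤ^d`. -/
def evenLattice (d : ℕ) : Set (Fin d → ℤ) := Set.range fun m : Fin d → ℤ => (2 : ℤ) • m

/-- The function `(1 - e^{-iz}) / (iz)`, with its continuous value `1` at `z = 0`. -/
def boxFactor (z : ℝ) : ℂ :=
  if z = 0 then 1 else (1 - Complex.exp (-(Complex.I * (z : ℂ)))) / (Complex.I * (z : ℂ))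

/-- The Fourier transform of the box spline `M_P`: the product of `(1 - e^{-ik·ξ}) / (ik·ξ)`
over the columns `k` of `P`. -/
def boxSplineHat {d n : ℕ} (P : Matrix (Fin d) (Fin n) ℤ) (ξ : E d) : ℂ :=
  ∏ j, boxFactor (inner ℝ (pt fun i => P i j) ξ)

/-- The infinite product `∏_{j ≥ 1} â(2^{-j} ξ)`. -/
def refinableHat {d : ℕ} (a : Filt d) (ξ : E d) : ℂ :=
  ∏' j : ℕ, fourierSeries a (((2 : ℝ) ^ (j + 1))⁻¹ • ξ)

/-- The tempered distribution `T` is integration against the function `f`. -/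
def IsRepresentedBy {d : ℕ} (T : 𝓢'(E d, ℂ)) (f : E d → ℂ) : Prop :=
  ∀ u : 𝓢(E d, ℂ), Integrable (fun x => u x * f x) ∧ T u = ∫ x, u x * f x

/-- The tempered distribution `T` has the function `g` as its Fourier transform, in the
normalization `f̂(ξ) = ∫ f(x) e^{-i x·ξ} dx`; Mathlib's transform is `(𝓕 f)(η) = f̂(2πη)`. -/
def HasFourierTransform {d : ℕ} (T : 𝓢'(E d, ℂ)) (g : E d → ℂ) : Prop :=
  IsRepresentedBy (𝓕 T) fun η => g ((2 * Real.pi) • η)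

/-- `φ` is the box spline with direction matrix `P`. -/
def IsBoxSpline {d n : ℕ} (P : Matrix (Fin d) (Fin n) ℤ) (φ : 𝓢'(E d, ℂ)) : Prop :=
  HasFourierTransform φ (boxSplineHat P)

/-- `φ, ψ₁, …, ψ_s` are defined from the filters `a; b₁, …, b_s` by
`φ̂(ξ) = ∏_{j ≥ 1} â(2^{-j} ξ)` and `ψ̂_l(ξ) = b̂_l(ξ/2) φ̂(ξ/2)`. -/
structure IsGeneratedBy {d s : ℕ} (a : Filt d) (b : Fin s → Filt d)
    (φ : 𝓢'(E d, ℂ)) (ψ : Fin s → 𝓢'(E d, ℂ)) : Prop where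
  phi : HasFourierTransform φ (refinableHat a)
  psi : ∀ l, HasFourierTransform (ψ l) fun ξ =>
    fourierSeries (b l) ((2 : ℝ)⁻¹ • ξ) * refinableHat a ((2 : ℝ)⁻¹ • ξ)

/-- The inner product `⟨f, g⟩ = ∫ f ḡ` of `L₂(ℝ^d)`. -/
def pairing {d : ℕ} (f g : E d → ℂ) : ℂ := ∫ x, f x * conj (g x)

/-- `{φ; ψ₁, …, ψ_s}` is a (nonhomogeneous) tight framelet in `L₂(ℝ^d)`. The sums are sums of
nonnegative extended reals. -/
structure IsTightFramelet {d s : ℕ} (φ : E d → ℂ) (ψ : Fin s → E d → ℂ) : Prop where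
  memLp_phi : MemLp φ 2
  memLp_psi : ∀ l, MemLp (ψ l) 2
  norm_sq : ∀ f : E d → ℂ, MemLp f 2 →
    ∫⁻ x, ‖f x‖ₑ ^ 2 =
      ∑' k : Fin d → ℤ, ‖pairing f fun x => φ (x - pt k)‖ₑ ^ 2 +
      ∑' j : ℕ, ∑ l, ∑' k : Fin d → ℤ,
        ‖pairing f fun x =>
          (((2 : ℝ) ^ ((j : ℝ) * d / 2) : ℝ) : ℂ) * ψ l (((2 : ℝ) ^ j) • x - pt k)‖ₑ ^ 2

end BoxSpline

end

open BoxSpline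

namespace BoxSpline

/-! ### Filters and their projections -/

/-! Everything rests on the polarized variance identity on the complete graph with vertex set
`{0,1}^n`: product of the sums plus the sum of edge differences equals `2 ^ n` times the inner
product (`IsEdgeEnumeration.sum_mul_conj_sum`). Applied to the characters `e^{-i Pγ·ξ}`, it reduces
the filter bank equation to a sum of signs `(-1)^{(Pᵀω)·γ}` over the cube. This sum factors over
coordinates and vanishes for `ω ≠ 0`, because the parity hypothesis makes some coordinate of `Pᵀω`
odd.

The projected low-pass symbol is a product over the columns of `P`, and each factor doubles one box
factor. Hence the refinement equation holds on the Fourier side and the infinite product telescopes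
to `boxSplineHat P`. Since `P` has rank `d`, it maps `ℝ^n` onto `ℝ^d`, and the image of the uniform
measure on the unit cube has a bounded, compactly supported density with this transform
(`exists_boxSpline`). Injectivity of the Fourier transform on tempered distributions identifies this
density with every admissible `φ`.

The framelet identity is proved in the space domain. Let `E_j` be the energy of the coefficients
against the translates of `φ` at level `j`. The refinement equation and the variance identity
express `E_j` plus the wavelet energies through level `j + 1` coefficients at the points `2k + Pγ`.
By the parity hypothesis every lattice point is reached equally often, so the total is exactly
`E_{j+1}` (`levelEnergy_succ`). For continuous compactly supported `f`, `E_J` is the squared norm of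
averages of `f` at scale `2^{-J}` and tends to `‖f‖²` because `∫ φ = 1` (`tendsto_levelEnergy`).
Monotonicity of `E_J` and density extend the limit to `L₂`, and telescoping gives the identity. -/

/-- The exponential `e^{-i k·ξ}`. -/
noncomputable def character {d : ℕ} (k : Fin d → ℤ) (ξ : E d) : ℂ :=
  Complex.exp (-(Complex.I * ((inner ℝ (pt k) ξ : ℝ) : ℂ)))

lemma fourierSeries_eq_linearCombination {d : ℕ} (a : Filt d) (ξ : E d) :
    fourierSeries a ξ = Finsupp.linearCombination ℂ (fun k => character k ξ) a := by
  simp [fourierSeries, Finsupp.linearCombination_apply, character]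

lemma fourierSeries_dirac {d : ℕ} (γ : Fin d → ℤ) (ξ : E d) :
    fourierSeries (dirac γ) ξ = character γ ξ := by
  simp [fourierSeries_eq_linearCombination, dirac]

lemma project_dirac {d n : ℕ} (P : Matrix (Fin d) (Fin n) ℤ) (γ : Fin n → ℤ) :
    project P (dirac γ) = dirac (P *ᵥ γ) := by
  simp [project, dirac, Finsupp.mapDomain_single]

lemma project_haarLowPass {d n : ℕ} (P : Matrix (Fin d) (Fin n) ℤ) :
    project P (haarLowPass n) = ∑ γ ∈ cubeVertices n, ((2 : ℂ) ^ n)⁻¹ • dirac (P *ᵥ γ) := by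
  simp only [haarLowPass, project, Finsupp.mapDomain_finsetSum, Finsupp.mapDomain_smul]
  exact Finset.sum_congr rfl fun γ _ => by rw [← project_dirac]; rfl

lemma project_haarHighPass {d n : ℕ} (P : Matrix (Fin d) (Fin n) ℤ)
    (e : (Fin n → ℤ) × (Fin n → ℤ)) :
    project P (haarHighPass e) = ((2 : ℂ) ^ n)⁻¹ • (dirac (P *ᵥ e.1) - dirac (P *ᵥ e.2)) := by
  rw [← project_dirac, ← project_dirac]
  change Finsupp.lmapDomain ℂ ℂ (fun k => P *ᵥ k) _ = _ •
    (Finsupp.lmapDomain ℂ ℂ (fun k => P *ᵥ k) _ - Finsupp.lmapDomain ℂ ℂ (fun k => P *ᵥ k) _)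
  rw [← map_sub, ← map_smul]
  rfl

lemma fourierSeries_project_haarLowPass {d n : ℕ} (P : Matrix (Fin d) (Fin n) ℤ) (ξ : E d) :
    fourierSeries (project P (haarLowPass n)) ξ =
      ((2 : ℂ) ^ n)⁻¹ * ∑ γ ∈ cubeVertices n, character (P *ᵥ γ) ξ := by
  rw [project_haarLowPass, fourierSeries_eq_linearCombination, map_sum, Finset.mul_sum]
  refine Finset.sum_congr rfl fun γ _ => ?_
  rw [map_smul, ← fourierSeries_eq_linearCombination, fourierSeries_dirac, smul_eq_mul]

lemma fourierSeries_project_haarHighPass {d n : ℕ} (P : Matrix (Fin d) (Fin n) ℤ)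
    (e : (Fin n → ℤ) × (Fin n → ℤ)) (ξ : E d) :
    fourierSeries (project P (haarHighPass e)) ξ =
      ((2 : ℂ) ^ n)⁻¹ * (character (P *ᵥ e.1) ξ - character (P *ᵥ e.2) ξ) := by
  rw [project_haarHighPass, fourierSeries_eq_linearCombination, map_smul, map_sub,
    ← fourierSeries_eq_linearCombination, ← fourierSeries_eq_linearCombination,
    fourierSeries_dirac, fourierSeries_dirac, smul_eq_mul]

lemma inner_pt {d : ℕ} (k : Fin d → ℤ) (ξ : E d) : inner ℝ (pt k) ξ = ∑ i, (k i : ℝ) * ξ i := by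
  simp [PiLp.inner_apply, pt, mul_comm]

lemma inner_pt_mulVec {d n : ℕ} (P : Matrix (Fin d) (Fin n) ℤ) (k : Fin n → ℤ) (ξ : E d) :
    inner ℝ (pt (P *ᵥ k)) ξ = ∑ j, (k j : ℝ) * inner ℝ (pt fun i => P i j) ξ := by
  simp only [inner_pt, Matrix.mulVec, dotProduct, Int.cast_sum, Int.cast_mul, Finset.sum_mul,
    Finset.mul_sum]
  rw [Finset.sum_comm]
  exact Finset.sum_congr rfl fun _ _ => Finset.sum_congr rfl fun _ _ => by ring

lemma card_cubeVertices (n : ℕ) : (cubeVertices n).card = 2 ^ n := by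
  simp [cubeVertices]

lemma sum_cubeVertices_prod {R : Type*} [CommSemiring R] {n : ℕ} (f : Fin n → ℤ → R) :
    ∑ γ ∈ cubeVertices n, ∏ j, f j (γ j) = ∏ j, (f j 0 + f j 1) := by
  rw [cubeVertices, ← Finset.prod_univ_sum]
  exact Finset.prod_congr rfl fun j _ => Finset.sum_pair (by norm_num)

lemma fourierSeries_project_haarLowPass_eq_prod {d n : ℕ} (P : Matrix (Fin d) (Fin n) ℤ)
    (ξ : E d) :
    fourierSeries (project P (haarLowPass n)) ξ =
      ∏ j, ((1 + Complex.exp (-(Complex.I * ((inner ℝ (pt fun i => P i j) ξ : ℝ) : ℂ)))) / 2) := by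
  let F : Fin n → ℤ → ℂ := fun j x =>
    Complex.exp (-(Complex.I * ((x * inner ℝ (pt fun i => P i j) ξ : ℝ) : ℂ)))
  have h (γ : Fin n → ℤ) : character (P *ᵥ γ) ξ = ∏ j, F j (γ j) := by
    rw [← Complex.exp_sum, character, inner_pt_mulVec]
    simp [Finset.mul_sum]
  rw [fourierSeries_project_haarLowPass, Finset.sum_congr rfl fun γ _ => h γ,
    sum_cubeVertices_prod F, Finset.prod_div_distrib]
  simp [div_eq_inv_mul, F]

lemma isDirectionalFilter_project_haarHighPass {d n : ℕ} (P : Matrix (Fin d) (Fin n) ℤ)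
    {e : (Fin n → ℤ) × (Fin n → ℤ)} (he : P *ᵥ e.1 ≠ P *ᵥ e.2) :
    IsDirectionalFilter (project P (haarHighPass e)) :=
  ⟨P *ᵥ e.1, P *ᵥ e.2, ((2 : ℝ) ^ n)⁻¹, he, by positivity, by
    rw [project_haarHighPass]; push_cast; rfl⟩

lemma project_haarHighPass_eq_zero {d n : ℕ} (P : Matrix (Fin d) (Fin n) ℤ)
    {e : (Fin n → ℤ) × (Fin n → ℤ)} (he : P *ᵥ e.1 = P *ᵥ e.2) :
    project P (haarHighPass e) = 0 := by
  rw [project_haarHighPass, he, sub_self, smul_zero]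

/-! ### Sums over the edges of the cube -/

/-- Adding both orientations removes the arbitrary choice made by `e`: each ordered pair of distinct
vertices then occurs exactly once. -/
lemma IsEdgeEnumeration.sum_add_swap {n s : ℕ} {e : Fin s → (Fin n → ℤ) × (Fin n → ℤ)}
    (he : IsEdgeEnumeration e) {M : Type*} [AddCommMonoid M]
    (F : (Fin n → ℤ) × (Fin n → ℤ) → M) :
    ∑ l, (F (e l) + F (e l).swap) = ∑ p ∈ (cubeVertices n).offDiag, F p := by
  classical
  have key : ∀ l, F (e l) + F (e l).swap =
      ∑ p ∈ (cubeVertices n).offDiag, if e l = p ∨ e l = p.swap then F p else 0 := by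
    intro l
    rw [← Finset.sum_filter, ← Finset.sum_pair (f := F) (a := e l) (b := (e l).swap)]
    · refine Finset.sum_congr ?_ fun _ _ => rfl
      ext p
      simp only [Finset.mem_insert, Finset.mem_singleton, Finset.mem_filter, Finset.mem_offDiag]
      constructor
      · rintro (rfl | rfl)
        · exact ⟨⟨he.fst_mem l, he.snd_mem l, he.ne l⟩, Or.inl rfl⟩
        · exact ⟨⟨he.snd_mem l, he.fst_mem l, (he.ne l).symm⟩, Or.inr (by simp)⟩
      · rintro ⟨-, h | h⟩
        · exact Or.inl h.symm
        · exact Or.inr (by rw [h, Prod.swap_swap])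
    · intro h
      exact he.ne l (congrArg Prod.fst h)
  rw [Finset.sum_congr rfl fun l _ => key l, Finset.sum_comm]
  refine Finset.sum_congr rfl fun p hp => ?_
  rw [Finset.mem_offDiag] at hp
  obtain ⟨l, hl, huniq⟩ := he.existsUnique p.1 hp.1 p.2 hp.2.1 hp.2.2
  refine (Finset.sum_eq_single l (fun l' _ hne => if_neg fun h => hne (huniq l' h))
    (fun h => absurd (Finset.mem_univ l) h)).trans ?_
  exact if_pos hl

/-- Polarized variance identity for functions on the vertices of the cube. -/
lemma IsEdgeEnumeration.sum_mul_conj_sum {n s : ℕ} {e : Fin s → (Fin n → ℤ) × (Fin n → ℤ)}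
    (he : IsEdgeEnumeration e) (z w : (Fin n → ℤ) → ℂ) :
    (∑ γ ∈ cubeVertices n, z γ) * conj (∑ γ ∈ cubeVertices n, w γ) +
      ∑ l, (z (e l).1 - z (e l).2) * conj (w (e l).1 - w (e l).2) =
    2 ^ n * ∑ γ ∈ cubeVertices n, z γ * conj (w γ) := by
  classical
  set V := cubeVertices n with hV
  let F : (Fin n → ℤ) × (Fin n → ℤ) → ℂ := fun p => (z p.1 - z p.2) * conj (w p.1 - w p.2)
  -- `F` is invariant under swapping and vanishes on the diagonal, so the full double sum counts
  -- every edge twice.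
  have h1 : 2 * ∑ l, F (e l) = ∑ p ∈ V ×ˢ V, F p := by
    rw [Finset.mul_sum, ← Finset.diag_union_offDiag,
      Finset.sum_union (Finset.disjoint_diag_offDiag _), ← he.sum_add_swap]
    rw [Finset.sum_eq_zero (s := V.diag), zero_add]
    · refine Finset.sum_congr rfl fun l _ => ?_
      simp only [F, Prod.fst_swap, Prod.snd_swap, map_sub]
      ring
    · intro p hp
      simp [F, (Finset.mem_diag.1 hp).2]
  have h2 : ∑ p ∈ V ×ˢ V, F p = 2 * (2 ^ n * ∑ γ ∈ V, z γ * conj (w γ)) -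
      2 * ((∑ γ ∈ V, z γ) * conj (∑ γ ∈ V, w γ)) := by
    have hc : (V.card : ℂ) = 2 ^ n := by rw [hV, card_cubeVertices]; push_cast; rfl
    have : ∀ p, F p = z p.1 * conj (w p.1) + z p.2 * conj (w p.2) - z p.1 * conj (w p.2)
        - z p.2 * conj (w p.1) := fun p => by simp only [F, map_sub]; ring
    simp only [this, Finset.sum_sub_distrib, Finset.sum_add_distrib, Finset.sum_product,
      Finset.sum_const, nsmul_eq_mul, ← Finset.mul_sum, ← Finset.sum_mul, hc, map_sum]
    ring
  have h3 : ∑ l, (z (e l).1 - z (e l).2) * conj (w (e l).1 - w (e l).2) = ∑ l, F (e l) := rfl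
  rw [h3]
  linear_combination (1 / 2 : ℂ) * h1 + (1 / 2 : ℂ) * h2

/-! ### The tight framelet filter bank -/

lemma odd_of_not_mem_evenLattice {n : ℕ} {k : Fin n → ℤ} (hk : k ∉ evenLattice n) :
    ∃ j, Odd (k j) := by
  by_contra! h
  simp only [Int.not_odd_iff_even] at h
  choose m hm using h
  exact hk ⟨m, funext fun j => by simp [hm j, two_mul]⟩

lemma not_mem_evenLattice_of_mem_cubeVertices {d : ℕ} {ω : Fin d → ℤ} (h : ω ∈ cubeVertices d)
    (h0 : ω ≠ 0) : ω ∉ evenLattice d := by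
  rintro ⟨m, rfl⟩
  refine h0 (funext fun i => ?_)
  have := Fintype.mem_piFinset.1 h i
  simp only [Pi.smul_apply, smul_eq_mul, Finset.mem_insert, Finset.mem_singleton] at this
  simp only [Pi.smul_apply, smul_eq_mul, Pi.zero_apply]
  omega

lemma inner_pt_column {d n : ℕ} (P : Matrix (Fin d) (Fin n) ℤ) (ω : Fin d → ℤ) (j : Fin n) :
    inner ℝ (pt fun i => P i j) (pt ω) = (((Pᵀ *ᵥ ω) j : ℤ) : ℝ) := by
  rw [inner_pt]
  simp [pt, Matrix.mulVec, dotProduct]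

/-- The dependence on `ξ` cancels; only the phase from the shift `πω` remains, and it splits over
the coordinates of `γ`. -/
lemma character_mul_conj_character_add {d n : ℕ} (P : Matrix (Fin d) (Fin n) ℤ) (γ : Fin n → ℤ)
    (ξ : E d) (ω : Fin d → ℤ) :
    character (P *ᵥ γ) ξ * conj (character (P *ᵥ γ) (ξ + Real.pi • pt ω)) =
      ∏ j, Complex.exp (Complex.I * Real.pi * (Pᵀ *ᵥ ω) j * γ j) := by
  rw [character, character, ← Complex.exp_conj, ← Complex.exp_add, ← Complex.exp_sum]
  congr 1
  rw [inner_add_right, inner_smul_right, inner_pt_mulVec P γ (pt ω)]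
  simp only [inner_pt_column]
  simp [Finset.mul_sum]
  ring_nf
  simp only [Finset.mul_sum]
  exact Finset.sum_congr rfl fun _ _ => by ring

theorem isTightFrameletFilterBank_project {d n s : ℕ} (P : Matrix (Fin d) (Fin n) ℤ)
    (hP : Set.MapsTo (fun k : Fin d → ℤ => Pᵀ *ᵥ k) (evenLattice d)ᶜ (evenLattice n)ᶜ)
    {e : Fin s → (Fin n → ℤ) × (Fin n → ℤ)} (he : IsEdgeEnumeration e) :
    IsTightFrameletFilterBank (project P (haarLowPass n))
      (fun l => project P (haarHighPass (e l))) := by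
  intro ξ ω hω
  simp only [fourierSeries_project_haarLowPass, fourierSeries_project_haarHighPass]
  have h2 : (2 : ℂ) ^ n ≠ 0 := pow_ne_zero _ two_ne_zero
  have key := he.sum_mul_conj_sum (fun γ => character (P *ᵥ γ) ξ)
    (fun γ => character (P *ᵥ γ) (ξ + Real.pi • pt ω))
  have hc : conj (((2 : ℂ) ^ n)⁻¹) = ((2 : ℂ) ^ n)⁻¹ := by simp [map_ofNat]
  simp only [map_mul (starRingEnd ℂ), hc]
  have : ∀ l, ((2 : ℂ) ^ n)⁻¹ * (character (P *ᵥ (e l).1) ξ - character (P *ᵥ (e l).2) ξ) *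
      (((2 : ℂ) ^ n)⁻¹ * conj (character (P *ᵥ (e l).1) (ξ + Real.pi • pt ω) -
        character (P *ᵥ (e l).2) (ξ + Real.pi • pt ω))) = ((2 : ℂ) ^ n)⁻¹ * ((2 : ℂ) ^ n)⁻¹ *
      ((character (P *ᵥ (e l).1) ξ - character (P *ᵥ (e l).2) ξ) *
      conj (character (P *ᵥ (e l).1) (ξ + Real.pi • pt ω) -
        character (P *ᵥ (e l).2) (ξ + Real.pi • pt ω))) := fun l => by ring
  rw [Finset.sum_congr rfl fun l _ => this l, ← Finset.mul_sum, mul_mul_mul_comm, ← mul_add, key,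
    Finset.sum_congr rfl fun γ _ => character_mul_conj_character_add P γ ξ ω]
  rw [sum_cubeVertices_prod fun j x => Complex.exp (Complex.I * Real.pi * (Pᵀ *ᵥ ω) j * (x : ℤ))]
  split_ifs with h0
  · simp only [h0, Matrix.mulVec_zero, Pi.zero_apply, Int.cast_zero, mul_zero, zero_mul,
      Complex.exp_zero, Finset.prod_const, Finset.card_univ, Fintype.card_fin]
    norm_num
    field_simp
  -- For odd `(Pᵀω)_j` the `j`-th factor is `1 + e^{iπ(2m+1)} = 0`, which kills the product.
  · obtain ⟨j, m, hm⟩ := odd_of_not_mem_evenLattice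
      (hP (not_mem_evenLattice_of_mem_cubeVertices hω h0))
    rw [Finset.prod_eq_zero (Finset.mem_univ j), mul_zero, mul_zero]
    simp only at hm
    rw [hm]
    have : Complex.I * Real.pi * ((2 * m + 1 : ℤ) : ℂ) * ((1 : ℤ) : ℂ) =
        Real.pi * Complex.I + m * (2 * Real.pi * Complex.I) := by push_cast; ring
    rw [this, Complex.exp_add, Complex.exp_pi_mul_I, Complex.exp_int_mul_two_pi_mul_I]
    simp

/-! ### The refinement equation on the Fourier side -/

/-- Away from zero this is `1 - w² = (1 - w)(1 + w)` with `w = e^{-iz}`. -/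
lemma boxFactor_two_mul (z : ℝ) :
    boxFactor (2 * z) = (1 + Complex.exp (-(Complex.I * (z : ℂ)))) / 2 * boxFactor z := by
  rcases eq_or_ne z 0 with rfl | hz
  · norm_num [boxFactor]
  · have hz' : (z : ℂ) ≠ 0 := Complex.ofReal_ne_zero.2 hz
    have h2 : Complex.exp (-(Complex.I * ((2 * z : ℝ) : ℂ))) =
        Complex.exp (-(Complex.I * (z : ℂ))) ^ 2 := by
      rw [← Complex.exp_nat_mul]
      congr 1
      push_cast
      ring
    rw [boxFactor, boxFactor, if_neg (mul_ne_zero two_ne_zero hz), if_neg hz, h2]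
    push_cast
    field_simp [Complex.I_ne_zero]
    ring

theorem boxSplineHat_two_smul {d n : ℕ} (P : Matrix (Fin d) (Fin n) ℤ) (ξ : E d) :
    boxSplineHat P ((2 : ℝ) • ξ) =
      fourierSeries (project P (haarLowPass n)) ξ * boxSplineHat P ξ := by
  rw [fourierSeries_project_haarLowPass_eq_prod, boxSplineHat, boxSplineHat,
    ← Finset.prod_mul_distrib]
  refine Finset.prod_congr rfl fun j _ => ?_
  rw [inner_smul_right, boxFactor_two_mul]

lemma character_zero {d : ℕ} (k : Fin d → ℤ) : character k (0 : E d) = 1 := by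
  simp [character]

theorem fourierSeries_project_haarLowPass_zero {d n : ℕ} (P : Matrix (Fin d) (Fin n) ℤ) :
    fourierSeries (project P (haarLowPass n)) 0 = 1 := by
  rw [fourierSeries_project_haarLowPass]
  simp [character_zero, card_cubeVertices]

/-! ### The infinite product -/

/-- This form gives continuity at `z = 0` and later recognizes the box factor as the transform of
the uniform law on an interval. -/
lemma boxFactor_eq_integral (z : ℝ) :
    boxFactor z = ∫ t in (0 : ℝ)..1, Complex.exp (-(Complex.I * ((t * z : ℝ) : ℂ))) := by
  rcases eq_or_ne z 0 with rfl | hz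
  · simp [boxFactor]
  · have hz' : (z : ℂ) ≠ 0 := Complex.ofReal_ne_zero.2 hz
    have hc : -(Complex.I * (z : ℂ)) ≠ 0 := neg_ne_zero.2 (mul_ne_zero Complex.I_ne_zero hz')
    have h := integral_exp_mul_complex (a := 0) (b := 1) hc
    have h' : ∀ t : ℝ, -(Complex.I * ((t * z : ℝ) : ℂ)) = -(Complex.I * (z : ℂ)) * t :=
      fun t => by push_cast; ring
    simp only [h', h, boxFactor, if_neg hz]
    simp only [Complex.ofReal_one, Complex.ofReal_zero, mul_one, mul_zero, Complex.exp_zero]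
    rw [div_neg, ← neg_div, neg_sub]

lemma continuous_boxFactor : Continuous boxFactor := by
  rw [funext boxFactor_eq_integral]
  exact intervalIntegral.continuous_parametric_intervalIntegral_of_continuous' (by fun_prop) _ _

lemma continuous_boxSplineHat {d n : ℕ} (P : Matrix (Fin d) (Fin n) ℤ) :
    Continuous (boxSplineHat P) :=
  continuous_finsetProd _ fun j _ => continuous_boxFactor.comp (by fun_prop)

lemma boxSplineHat_zero {d n : ℕ} (P : Matrix (Fin d) (Fin n) ℤ) : boxSplineHat P 0 = 1 := by
  simp [boxSplineHat, boxFactor]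

lemma norm_character_sub_one_le {d : ℕ} (k : Fin d → ℤ) (ξ : E d) :
    ‖character k ξ - 1‖ ≤ |inner ℝ (pt k) ξ| := by
  have := Real.norm_exp_I_mul_ofReal_sub_one_le (x := -inner ℝ (pt k) ξ)
  rw [norm_neg, Real.norm_eq_abs] at this
  rw [character, ← mul_neg, ← Complex.ofReal_neg]
  exact this

/-- The bound is homogeneous of degree one in `ξ`, so along the points `2^{-j} ξ` it decays
geometrically and the infinite product converges absolutely. -/
lemma norm_fourierSeries_project_haarLowPass_sub_one_le {d n : ℕ} (P : Matrix (Fin d) (Fin n) ℤ)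
    (ξ : E d) : ‖fourierSeries (project P (haarLowPass n)) ξ - 1‖ ≤
      ((2 : ℝ) ^ n)⁻¹ * ∑ γ ∈ cubeVertices n, |inner ℝ (pt (P *ᵥ γ)) ξ| := by
  have h1 : (1 : ℂ) = ((2 : ℂ) ^ n)⁻¹ * ∑ γ ∈ cubeVertices n, 1 := by
    simp [card_cubeVertices]
  rw [fourierSeries_project_haarLowPass, h1, ← mul_sub, ← Finset.sum_sub_distrib, norm_mul]
  simp only [norm_inv, norm_pow, Complex.norm_ofNat]
  gcongr
  refine (norm_sum_le _ _).trans (Finset.sum_le_sum fun γ _ => ?_)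
  exact norm_character_sub_one_le _ _

theorem multipliable_fourierSeries_project_haarLowPass {d n : ℕ} (P : Matrix (Fin d) (Fin n) ℤ)
    (ξ : E d) : Multipliable fun j : ℕ =>
      fourierSeries (project P (haarLowPass n)) (((2 : ℝ) ^ (j + 1))⁻¹ • ξ) := by
  have : Summable fun j : ℕ =>
      ‖fourierSeries (project P (haarLowPass n)) (((2 : ℝ) ^ (j + 1))⁻¹ • ξ) - 1‖ := by
    refine Summable.of_nonneg_of_le (fun _ => norm_nonneg _)
      (fun j => norm_fourierSeries_project_haarLowPass_sub_one_le P _) ?_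
    simp only [inner_smul_right, abs_mul, ← Finset.mul_sum]
    refine Summable.mul_left _ (Summable.mul_right _ ?_)
    simp only [abs_inv, abs_pow, abs_two, ← inv_pow]
    exact (summable_nat_add_iff 1).2 (summable_geometric_of_lt_one (by norm_num) (by norm_num))
  simpa using multipliable_one_add_of_summable this

/-- Iterating the refinement equation leaves a remainder that tends to `boxSplineHat P 0 = 1`. -/
lemma boxSplineHat_eq_prod_range_mul {d n : ℕ} (P : Matrix (Fin d) (Fin n) ℤ) (ξ : E d) (J : ℕ) :
    boxSplineHat P ξ = (∏ j ∈ Finset.range J,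
      fourierSeries (project P (haarLowPass n)) (((2 : ℝ) ^ (j + 1))⁻¹ • ξ)) *
        boxSplineHat P (((2 : ℝ) ^ J)⁻¹ • ξ) := by
  induction J with
  | zero => simp
  | succ J ih =>
    rw [Finset.prod_range_succ, mul_assoc, ← boxSplineHat_two_smul, smul_smul]
    convert ih using 4
    rw [pow_succ]
    field_simp

theorem refinableHat_project_haarLowPass {d n : ℕ} (P : Matrix (Fin d) (Fin n) ℤ) :
    refinableHat (project P (haarLowPass n)) = boxSplineHat P := by
  ext ξ
  have h1 := (multipliable_fourierSeries_project_haarLowPass P ξ).hasProd.tendsto_prod_nat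
  have h2 : Filter.Tendsto (fun J : ℕ => boxSplineHat P (((2 : ℝ) ^ J)⁻¹ • ξ)) Filter.atTop
      (nhds 1) := by
    have h3 : Filter.Tendsto (fun J : ℕ => ((2 : ℝ) ^ J)⁻¹ • ξ) Filter.atTop (nhds 0) := by
      have := (tendsto_pow_atTop_nhds_zero_of_lt_one (r := (2 : ℝ)⁻¹) (by norm_num)
        (by norm_num)).smul_const ξ
      simpa [inv_pow] using this
    have := ((continuous_boxSplineHat P).tendsto 0).comp h3
    rwa [boxSplineHat_zero] at this
  have h4 := h1.mul h2
  simp only [← boxSplineHat_eq_prod_range_mul, mul_one] at h4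
  exact tendsto_nhds_unique h4 tendsto_const_nhds

end BoxSpline

/-! ### Bounded densities of linear images of cubes -/

/-- The image of a compact piece of a Haar measure under a surjective linear map is bounded by a
finite multiple of Haar measure. -/
theorem LinearMap.exists_map_restrict_le_smul_addHaar {V W : Type*}
    [NormedAddCommGroup V] [NormedSpace ℝ V] [FiniteDimensional ℝ V] [MeasurableSpace V]
    [BorelSpace V] [NormedAddCommGroup W] [NormedSpace ℝ W] [FiniteDimensional ℝ W]
    [MeasurableSpace W] [BorelSpace W] (L : V →ₗ[ℝ] W) (hL : Function.Surjective L)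
    (μ : Measure V) [μ.IsAddHaarMeasure] (ν : Measure W) [ν.IsAddHaarMeasure]
    {K : Set V} (hK : IsCompact K) :
    ∃ C : ℝ≥0∞, C ≠ ∞ ∧ (μ.restrict K).map L ≤ C • ν := by
  let S := LinearMap.ker L
  -- A projection `p` onto `ker L` gives an isomorphism `V ≃ W × ker L`, under which `μ` becomes a
  -- multiple of a product of Haar measures.
  obtain ⟨p, hp⟩ := S.subtype.exists_leftInverse_of_injective S.ker_subtype
  have hp' (s : S) : p s = s := LinearMap.congr_fun hp s
  have hbij : Function.Bijective (L.prod p) := by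
    constructor
    · rw [← LinearMap.ker_eq_bot, LinearMap.ker_eq_bot']
      intro v hv
      have h1 : L v = 0 := congrArg Prod.fst hv
      have h2 : p v = 0 := congrArg Prod.snd hv
      have := hp' ⟨v, h1⟩
      rw [h2] at this
      exact (congrArg Subtype.val this).symm
    · rintro ⟨w, s⟩
      obtain ⟨v, rfl⟩ := hL w
      refine ⟨v + (s - p v : S), ?_⟩
      have h0 : L ((s - p v : S) : V) = 0 := (s - p v).2
      refine Prod.ext ?_ ?_
      · change L (v + (s - p v : S)) = L v
        rw [map_add, h0, add_zero]
      · change p (v + (s - p v : S)) = s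
        rw [map_add, hp', add_sub_cancel]
  let M : V ≃ₗ[ℝ] W × S := LinearEquiv.ofBijective _ hbij
  let M' : V ≃L[ℝ] W × S := M.toContinuousLinearEquiv
  let σ : Measure S := Measure.addHaar
  have hM : (μ.map M').IsAddHaarMeasure := M'.isAddHaarMeasure_map μ
  have hc := Measure.isAddLeftInvariant_eq_smul (μ.map M') (ν.prod σ)
  set c := Measure.addHaarScalarFactor (μ.map M') (ν.prod σ)
  have hLm : Measurable L := L.continuous_of_finiteDimensional.measurable
  have hpK : IsCompact (p '' K) := hK.image p.continuous_of_finiteDimensional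
  -- Points of `K` over `A` lie in the slab `A ×ˢ (p '' K)`, whose measure is linear in `ν A`;
  -- compactness of `p '' K` makes the constant finite.
  refine ⟨c * σ (p '' K), ENNReal.mul_ne_top ENNReal.coe_ne_top hpK.measure_lt_top.ne, ?_⟩
  refine Measure.le_iff.2 fun A hA => ?_
  rw [Measure.map_apply hLm hA, Measure.restrict_apply (hLm hA)]
  calc μ (L ⁻¹' A ∩ K) ≤ μ (M' ⁻¹' (A ×ˢ (p '' K))) :=
        measure_mono fun v hv => ⟨hv.1, v, hv.2, rfl⟩
    _ = μ.map M' (A ×ˢ (p '' K)) := by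
        rw [Measure.map_apply M'.continuous.measurable (hA.prod hpK.measurableSet)]
    _ = (((c : ℝ≥0∞) * σ (p '' K)) • ν) A := by
        rw [hc, Measure.smul_apply, Measure.prod_prod, Measure.smul_apply, ENNReal.smul_def]
        simp only [smul_eq_mul]
        ring

/-- A measure which is bounded by a multiple of `ν` and concentrated on `K` has a bounded density
supported in `K`. -/
theorem MeasureTheory.Measure.exists_bounded_density {X : Type*} [MeasurableSpace X]
    (μ ν : Measure X) [SigmaFinite μ] [SigmaFinite ν] {C : ℝ≥0∞} (hC : C ≠ ∞) (h : μ ≤ C • ν)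
    {K : Set X} (hK : MeasurableSet K) (hμK : μ Kᶜ = 0) :
    ∃ f : X → ℝ, Measurable f ∧ (∀ x, 0 ≤ f x) ∧ (∀ x, f x ≤ C.toReal) ∧ (∀ x ∉ K, f x = 0) ∧
      μ = ν.withDensity fun x => ENNReal.ofReal (f x) := by
  have hac : μ ≪ ν := (Measure.absolutelyContinuous_of_le h).trans
    (Measure.smul_absolutelyContinuous)
  have hr := Measure.withDensity_rnDeriv_eq μ ν hac
  set r := μ.rnDeriv ν with hrdef
  have hrm : Measurable r := Measure.measurable_rnDeriv _ _
  have hrC : r ≤ᵐ[ν] fun _ => C := by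
    refine ae_le_of_forall_setLIntegral_le_of_sigmaFinite hrm fun s hs _ => ?_
    rw [← withDensity_apply _ hs, hr]
    simpa using h s
  have hr0 : ∀ᵐ x ∂ν, x ∈ Kᶜ → r x = 0 := by
    rw [← hr, withDensity_apply _ hK.compl, lintegral_eq_zero_iff hrm] at hμK
    exact (ae_restrict_iff' hK.compl).1 hμK
  -- Truncating at `C` and cutting off outside `K` changes the Radon–Nikodym derivative only on a
  -- null set, and makes the bounds hold at every point.
  refine ⟨fun x => (K.indicator (fun x => min (r x) C) x).toReal,
    ((hrm.min measurable_const).indicator hK).ennreal_toReal, fun x => ENNReal.toReal_nonneg,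
    fun x => ?_, fun x hx => ?_, ?_⟩
  · refine ENNReal.toReal_mono hC ?_
    by_cases hx : x ∈ K <;> simp [hx]
  · simp [hx]
  · rw [← hr]
    refine withDensity_congr_ae ?_
    filter_upwards [hrC, hr0] with x h1 h2
    by_cases hx : x ∈ K
    · simp only [Set.indicator_of_mem hx, min_eq_left h1]
      rw [ENNReal.ofReal_toReal (ne_top_of_le_ne_top hC h1)]
    · simp [hx, h2 hx]

namespace BoxSpline

/-! ### The box spline as the density of a projected cube. -/

/-- The linear map `ℝ^n → ℝ^d` with matrix `P`. -/
noncomputable def boxMap {d n : ℕ} (P : Matrix (Fin d) (Fin n) ℤ) : (Fin n → ℝ) →ₗ[ℝ] E d :=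
  (WithLp.linearEquiv 2 ℝ (Fin d → ℝ)).symm.toLinearMap ∘ₗ
    (P.map (Int.cast : ℤ → ℝ)).mulVecLin

lemma boxMap_surjective {d n : ℕ} (P : Matrix (Fin d) (Fin n) ℤ)
    (hrank : (P.map (Int.cast : ℤ → ℝ)).rank = d) : Function.Surjective (boxMap P) := by
  have : LinearMap.range (P.map (Int.cast : ℤ → ℝ)).mulVecLin = ⊤ :=
    Submodule.eq_top_of_finrank_eq (by rw [← Matrix.rank, hrank]; simp)
  exact (WithLp.linearEquiv 2 ℝ (Fin d → ℝ)).symm.surjective.comp (LinearMap.range_eq_top.1 this)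

lemma inner_boxMap {d n : ℕ} (P : Matrix (Fin d) (Fin n) ℤ) (t : Fin n → ℝ) (ξ : E d) :
    inner ℝ (boxMap P t) ξ = ∑ j, t j * inner ℝ (pt fun i => P i j) ξ := by
  have h : ∀ i, (boxMap P t) i = ∑ j, (P i j : ℝ) * t j := fun i => rfl
  simp only [PiLp.inner_apply, h, Finset.mul_sum, pt]
  rw [Finset.sum_comm]
  simp only [RCLike.inner_apply, conj_trivial, Finset.mul_sum]
  refine Finset.sum_congr rfl fun _ _ => Finset.sum_congr rfl fun _ _ => by ring

/-- The uniform distribution on the unit cube. -/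
noncomputable def cubeMeasure (n : ℕ) : Measure (Fin n → ℝ) :=
  Measure.pi fun _ => volume.restrict (Set.Ioc 0 1)

lemma cubeMeasure_eq (n : ℕ) :
    cubeMeasure n = volume.restrict (Set.univ.pi fun _ => Set.Ioc 0 1) := by
  rw [cubeMeasure, ← Measure.restrict_pi_pi]
  rfl

/-- The half-open cube fits interval integrals; the closed cube supplies the compactness needed for
a bounded density. -/
lemma cubeMeasure_le (n : ℕ) : cubeMeasure n ≤ volume.restrict (Set.Icc 0 1) := by
  rw [cubeMeasure_eq]
  refine Measure.restrict_mono (fun x hx => ?_) le_rfl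
  exact Set.mem_Icc.2 ⟨fun i => (hx i trivial).1.le, fun i => (hx i trivial).2⟩

/-- The phase is linear in `t`, so the integrand is a product over coordinates and Fubini yields one
box factor per column. -/
lemma integral_cubeMeasure {d n : ℕ} (P : Matrix (Fin d) (Fin n) ℤ) (ξ : E d) :
    ∫ t, Complex.exp (-(Complex.I * ((inner ℝ (boxMap P t) ξ : ℝ) : ℂ))) ∂cubeMeasure n =
      boxSplineHat P ξ := by
  have h (t : Fin n → ℝ) : Complex.exp (-(Complex.I * ((inner ℝ (boxMap P t) ξ : ℝ) : ℂ))) =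
      ∏ j, Complex.exp (-(Complex.I * ((t j * inner ℝ (pt fun i => P i j) ξ : ℝ) : ℂ))) := by
    rw [← Complex.exp_sum, inner_boxMap]
    simp [Finset.mul_sum]
  simp only [h, cubeMeasure]
  rw [integral_fintype_prod_eq_prod (𝕜 := ℂ) fun j (x : ℝ) =>
    Complex.exp (-(Complex.I * ((x * inner ℝ (pt fun i => P i j) ξ : ℝ) : ℂ)))]
  refine Finset.prod_congr rfl fun j _ => ?_
  rw [boxFactor_eq_integral, intervalIntegral.integral_of_le zero_le_one]

/-- The box spline is a bounded measurable function with compact support. -/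
theorem exists_boxSpline {d n : ℕ} (P : Matrix (Fin d) (Fin n) ℤ)
    (hrank : (P.map (Int.cast : ℤ → ℝ)).rank = d) :
    ∃ φ : E d → ℝ, Measurable φ ∧ (∃ C, ∀ x, ‖φ x‖ ≤ C) ∧ HasCompactSupport φ ∧
      ∀ ξ, ∫ x, Complex.exp (-(Complex.I * ((inner ℝ x ξ : ℝ) : ℂ))) * φ x =
        boxSplineHat P ξ := by
  have hcont : Continuous (boxMap P) := (boxMap P).continuous_of_finiteDimensional
  obtain ⟨C, hC, hle⟩ := (boxMap P).exists_map_restrict_le_smul_addHaar (boxMap_surjective P hrank)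
    volume volume (isCompact_Icc (a := (0 : Fin n → ℝ)) (b := 1))
  have hfin : IsFiniteMeasure (cubeMeasure n) := by
    rw [cubeMeasure]; infer_instance
  have hK : IsCompact (boxMap P '' Set.Icc 0 1) := isCompact_Icc.image hcont
  have hnull : (cubeMeasure n).map (boxMap P) (boxMap P '' Set.Icc 0 1)ᶜ = 0 := by
    rw [Measure.map_apply hcont.measurable hK.measurableSet.compl]
    refine le_antisymm ((cubeMeasure_le n _).trans ?_) zero_le
    rw [Measure.restrict_apply (hcont.measurable hK.measurableSet.compl)]
    refine (measure_mono_null ?_ measure_empty).le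
    rintro t ⟨h1, h2⟩
    exact h1 ⟨t, h2, rfl⟩
  obtain ⟨φ, hm, h0, hφC, hφK, hφ⟩ := Measure.exists_bounded_density
    ((cubeMeasure n).map (boxMap P)) volume hC
    ((Measure.map_mono (cubeMeasure_le n) hcont.measurable).trans hle) hK.measurableSet hnull
  refine ⟨φ, hm, ⟨C.toReal, fun x => ?_⟩, HasCompactSupport.intro hK hφK, fun ξ => ?_⟩
  · rw [Real.norm_of_nonneg (h0 x)]
    exact hφC x
  · rw [← integral_cubeMeasure, ← integral_map (μ := cubeMeasure n) (φ := boxMap P)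
      (f := fun x => Complex.exp (-(Complex.I * ((inner ℝ x ξ : ℝ) : ℂ))))
      hcont.measurable.aemeasurable (by fun_prop), hφ,
      integral_withDensity_eq_integral_toReal_smul (by fun_prop) (by simp)]
    refine integral_congr_ae (.of_forall fun x => ?_)
    simp only [ENNReal.toReal_ofReal (h0 x), Complex.real_smul, mul_comm]

/-! ### Bounded functions with compact support -/

/-- A bounded measurable function with compact support. -/
structure IsBoundedCompact {d : ℕ} (f : E d → ℂ) : Prop where
  measurable : Measurable f
  bounded : ∃ C, ∀ x, ‖f x‖ ≤ C
  compact : HasCompactSupport f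

namespace IsBoundedCompact

variable {d : ℕ} {f g : E d → ℂ}

lemma memLp (hf : IsBoundedCompact f) (p : ℝ≥0∞) : MemLp f p := by
  obtain ⟨C, hC⟩ := hf.bounded
  have hK : MeasurableSet (tsupport f) := (isClosed_tsupport f).measurableSet
  have : IsFiniteMeasure ((volume : Measure (E d)).restrict (tsupport f)) :=
    ⟨by simpa using hf.compact.isCompact.measure_lt_top⟩
  have h := MemLp.of_bound (μ := (volume : Measure (E d)).restrict (tsupport f)) (p := p)
    hf.measurable.aestronglyMeasurable C (.of_forall hC)
  rw [← memLp_indicator_iff_restrict hK] at h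
  rwa [Set.indicator_eq_self.2 (subset_tsupport f)] at h

lemma integrable (hf : IsBoundedCompact f) : Integrable f :=
  memLp_one_iff_integrable.1 (hf.memLp 1)

lemma zero : IsBoundedCompact (0 : E d → ℂ) :=
  ⟨measurable_const, ⟨0, fun x => by simp⟩, HasCompactSupport.zero⟩

lemma add (hf : IsBoundedCompact f) (hg : IsBoundedCompact g) : IsBoundedCompact (f + g) := by
  obtain ⟨C, hC⟩ := hf.bounded
  obtain ⟨D, hD⟩ := hg.bounded
  exact ⟨hf.measurable.add hg.measurable,
    ⟨C + D, fun x => (norm_add_le _ _).trans (add_le_add (hC x) (hD x))⟩,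
    hf.compact.add hg.compact⟩

lemma smul (hf : IsBoundedCompact f) (c : ℂ) : IsBoundedCompact (c • f) := by
  obtain ⟨C, hC⟩ := hf.bounded
  refine ⟨hf.measurable.const_smul c, ⟨‖c‖ * C, fun x => ?_⟩, hf.compact.smul_left (f := fun _ => c)⟩
  rw [Pi.smul_apply, norm_smul]
  exact mul_le_mul_of_nonneg_left (hC x) (norm_nonneg _)

lemma comp_smul_sub (hf : IsBoundedCompact f) {r : ℝ} (hr : r ≠ 0) (v : E d) :
    IsBoundedCompact fun x => f (r • x - v) := by
  obtain ⟨C, hC⟩ := hf.bounded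
  refine ⟨hf.measurable.comp (by fun_prop), ⟨C, fun x => hC _⟩, ?_⟩
  exact hf.compact.comp_homeomorph ((Homeomorph.smulOfNeZero r hr).trans (Homeomorph.subRight v))

lemma sum {ι : Type*} (s : Finset ι) {F : ι → E d → ℂ} (hF : ∀ i ∈ s, IsBoundedCompact (F i)) :
    IsBoundedCompact (∑ i ∈ s, F i) :=
  Finset.sum_induction F IsBoundedCompact (fun _ _ => add) zero hF

end IsBoundedCompact

/-! ### Fourier transforms -/

/-- The Fourier transform `∫ f(x) e^{-i x·ξ} dx`. -/
noncomputable def angularFourier {d : ℕ} (f : E d → ℂ) (ξ : E d) : ℂ :=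
  ∫ x, Complex.exp (-(Complex.I * ((inner ℝ x ξ : ℝ) : ℂ))) * f x

lemma fourier_eq_angularFourier {d : ℕ} (f : E d → ℂ) (η : E d) :
    𝓕 f η = angularFourier f ((2 * Real.pi) • η) := by
  rw [Real.fourier_eq', angularFourier]
  congr 1 with x
  rw [smul_eq_mul, inner_smul_right]
  congr 2
  push_cast
  ring

lemma integrable_schwartz_mul {d : ℕ} {f : E d → ℂ} (hf : Integrable f) (u : 𝓢(E d, ℂ)) :
    Integrable fun x => u x * f x :=
  hf.bdd_mul u.continuous.aestronglyMeasurable (.of_forall (SchwartzMap.norm_le_seminorm ℝ u))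

/-- Every integrable function represents a tempered distribution, whose Fourier transform is the
Fourier integral of the function. -/
theorem exists_temperedDistribution {d : ℕ} {f : E d → ℂ} (hf : Integrable f) :
    ∃ T : 𝓢'(E d, ℂ), IsRepresentedBy T f ∧ HasFourierTransform T (angularFourier f) := by
  have hf1 := memLp_one_iff_integrable.2 hf
  have hT (u : 𝓢(E d, ℂ)) : (Lp.toTemperedDistribution (hf1.toLp f)) u = ∫ x, u x * f x := by
    rw [Lp.toTemperedDistribution_apply]
    refine integral_congr_ae ?_
    filter_upwards [hf1.coeFn_toLp] with x hx
    rw [hx, smul_eq_mul]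
  refine ⟨Lp.toTemperedDistribution (hf1.toLp f), fun u => ⟨integrable_schwartz_mul hf u, hT u⟩,
    fun u => ⟨?_, ?_⟩⟩
  · simp only [← fourier_eq_angularFourier]
    have hb : ∀ η, ‖𝓕 f η‖ ≤ ∫ x, ‖f x‖ := fun η =>
      VectorFourier.norm_fourierIntegral_le_integral_norm _ _ _ _ _
    have hc : Continuous (𝓕 f) := VectorFourier.fourierIntegral_continuous
      Real.continuous_fourierChar continuous_inner hf
    exact u.integrable.mul_bdd hc.aestronglyMeasurable (.of_forall hb)
  · simp only [← fourier_eq_angularFourier]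
    rw [TemperedDistribution.fourier_apply, hT]
    simpa using! VectorFourier.integral_fourierIntegral_smul_eq_flip (L := innerₗ (E d))
      Real.continuous_fourierChar continuous_inner u.integrable hf

lemma HasFourierTransform.unique {d : ℕ} {T T' : 𝓢'(E d, ℂ)} {g : E d → ℂ}
    (h : HasFourierTransform T g) (h' : HasFourierTransform T' g) : T = T' := by
  have : 𝓕 T = 𝓕 T' := by
    ext u
    rw [(h u).2, (h' u).2]
  have h2 := congrArg (fun S : 𝓢'(E d, ℂ) => (𝓕⁻ S : 𝓢'(E d, ℂ))) this
  simpa only [FourierTransform.fourierInv_fourier_eq] using h2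

/-- An integrable function is determined by its Fourier transform. -/
theorem ae_eq_of_angularFourier_eq {d : ℕ} {f g : E d → ℂ} (hf : Integrable f) (hg : Integrable g)
    (h : angularFourier f = angularFourier g) : f =ᵐ[volume] g := by
  obtain ⟨T, hT, hT'⟩ := exists_temperedDistribution hf
  obtain ⟨S, hS, hS'⟩ := exists_temperedDistribution hg
  rw [h] at hT'
  obtain rfl := hT'.unique hS'
  have hf1 := memLp_one_iff_integrable.2 hf
  have hg1 := memLp_one_iff_integrable.2 hg
  refine (MemLp.toLp_eq_toLp_iff hf1 hg1).1 ?_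
  -- Both functions represent the same distribution, and `L¹` embeds injectively into tempered
  -- distributions.
  have hker := LinearMap.ker_eq_bot.1 (Lp.ker_toTemperedDistributionCLM_eq_bot (F := ℂ)
    (μ := (volume : Measure (E d))) (p := 1))
  apply hker
  ext u
  have hu (k : E d → ℂ) (hk : MemLp k 1) (hTk : IsRepresentedBy T k) :
      (Lp.toTemperedDistribution (hk.toLp k)) u = T u := by
    rw [(hTk u).2, Lp.toTemperedDistribution_apply]
    refine integral_congr_ae ?_
    filter_upwards [hk.coeFn_toLp] with x hx
    rw [hx, smul_eq_mul]
  exact (hu f hf1 hT).trans (hu g hg1 hS).symm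

/-! ### Refinement -/

/-- The function `2^d ∑ₖ a(k) f(2x - k)`. -/
noncomputable def subdivide {d : ℕ} (a : Filt d) (f : E d → ℂ) (x : E d) : ℂ :=
  Finsupp.linearCombination ℂ (fun k => (2 : ℂ) ^ d * f ((2 : ℝ) • x - pt k)) a

lemma subdivide_eq_sum {d : ℕ} (a : Filt d) (f : E d → ℂ) :
    subdivide a f = ∑ k ∈ a.support, (a k * (2 : ℂ) ^ d) • fun x => f ((2 : ℝ) • x - pt k) := by
  ext x
  simp [subdivide, Finsupp.linearCombination_apply, Finsupp.sum, mul_assoc]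

lemma IsBoundedCompact.subdivide {d : ℕ} {f : E d → ℂ} (hf : IsBoundedCompact f) (a : Filt d) :
    IsBoundedCompact (subdivide a f) := by
  rw [subdivide_eq_sum]
  exact IsBoundedCompact.sum _ fun k _ => (hf.comp_smul_sub two_ne_zero _).smul _

/-- The factor `2 ^ d` cancels the Jacobian of the dilation, and the translation produces the
character. -/
lemma angularFourier_comp_two_smul_sub {d : ℕ} (f : E d → ℂ) (k : Fin d → ℤ) (ξ : E d) :
    (2 : ℂ) ^ d * angularFourier (fun x => f ((2 : ℝ) • x - pt k)) ξ =
      character k ((2 : ℝ)⁻¹ • ξ) * angularFourier f ((2 : ℝ)⁻¹ • ξ) := by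
  let F : E d → ℂ := fun y =>
    Complex.exp (-(Complex.I * ((inner ℝ y ((2 : ℝ)⁻¹ • ξ) : ℝ) : ℂ))) * f (y - pt k)
  have h1 : angularFourier (fun x => f ((2 : ℝ) • x - pt k)) ξ = ∫ x, F ((2 : ℝ) • x) := by
    rw [angularFourier]
    congr 1 with x
    have : inner ℝ ((2 : ℝ) • x) ((2 : ℝ)⁻¹ • ξ) = inner ℝ x ξ := by
      rw [inner_smul_left, inner_smul_right]
      simp
    simp only [F, this]
  have h2 : ∫ y, F y = character k ((2 : ℝ)⁻¹ • ξ) * angularFourier f ((2 : ℝ)⁻¹ • ξ) := by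
    rw [← integral_add_right_eq_self F (pt k), angularFourier, ← integral_const_mul]
    congr 1 with y
    simp only [F, add_sub_cancel_right, inner_add_left, character]
    rw [← mul_assoc, ← Complex.exp_add]
    congr 2
    push_cast
    ring
  rw [h1, Measure.integral_comp_smul, h2, finrank_euclideanSpace_fin]
  rw [abs_of_pos (by positivity), Complex.real_smul, ← mul_assoc]
  push_cast
  rw [mul_inv_cancel₀ (pow_ne_zero _ two_ne_zero), one_mul]

lemma integrable_exp_mul {d : ℕ} {f : E d → ℂ} (hf : Integrable f) (ξ : E d) :
    Integrable fun x => Complex.exp (-(Complex.I * ((inner ℝ x ξ : ℝ) : ℂ))) * f x := by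
  refine hf.bdd_mul (c := 1) (by fun_prop) (.of_forall fun x => ?_)
  rw [Complex.norm_exp]
  simp

/-- Thus `subdivide` realizes the generators `ψ_l` as functions, and for the low-pass filter it
expresses the refinement equation. -/
theorem angularFourier_subdivide {d : ℕ} (a : Filt d) {f : E d → ℂ} (hf : IsBoundedCompact f)
    (ξ : E d) : angularFourier (subdivide a f) ξ =
      fourierSeries a ((2 : ℝ)⁻¹ • ξ) * angularFourier f ((2 : ℝ)⁻¹ • ξ) := by
  have h : angularFourier (subdivide a f) ξ =
      ∑ k ∈ a.support, a k * ((2 : ℂ) ^ d * angularFourier (fun x => f ((2 : ℝ) • x - pt k)) ξ) := by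
    simp only [subdivide_eq_sum, angularFourier, Finset.sum_apply, Finset.mul_sum]
    rw [integral_finsetSum]
    · refine Finset.sum_congr rfl fun k _ => ?_
      rw [← integral_const_mul, ← integral_const_mul]
      congr 1 with x
      simp only [Pi.smul_apply, smul_eq_mul]
      ring
    · exact fun k _ => integrable_exp_mul
        ((hf.comp_smul_sub two_ne_zero (pt k)).smul (a k * (2 : ℂ) ^ d)).integrable ξ
  simp only [h, angularFourier_comp_two_smul_sub, fourierSeries, Finsupp.sum, Finset.sum_mul,
    character]
  exact Finset.sum_congr rfl fun k _ => by ring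

lemma subdivide_project_haarLowPass {d n : ℕ} (P : Matrix (Fin d) (Fin n) ℤ) (f : E d → ℂ)
    (x : E d) : subdivide (project P (haarLowPass n)) f x =
      (2 : ℂ) ^ d * ((2 : ℂ) ^ n)⁻¹ *
        ∑ γ ∈ cubeVertices n, f ((2 : ℝ) • x - pt (P *ᵥ γ)) := by
  rw [project_haarLowPass, subdivide, map_sum, Finset.mul_sum]
  refine Finset.sum_congr rfl fun γ _ => ?_
  simp only [dirac, map_smul, Finsupp.linearCombination_single, smul_eq_mul]
  ring

lemma subdivide_project_haarHighPass {d n : ℕ} (P : Matrix (Fin d) (Fin n) ℤ)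
    (e : (Fin n → ℤ) × (Fin n → ℤ)) (f : E d → ℂ) (x : E d) :
    subdivide (project P (haarHighPass e)) f x = (2 : ℂ) ^ d * ((2 : ℂ) ^ n)⁻¹ *
      (f ((2 : ℝ) • x - pt (P *ᵥ e.1)) - f ((2 : ℝ) • x - pt (P *ᵥ e.2))) := by
  rw [project_haarHighPass, subdivide]
  simp only [dirac, map_smul, map_sub, Finsupp.linearCombination_single, smul_eq_mul]
  ring

/-! ### Residue classes modulo two -/

/-- The sign `(-1)^z` as a complex number. -/
noncomputable def sign (z : ℤ) : ℂ := Complex.exp (Complex.I * Real.pi * z)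

lemma sign_even {z : ℤ} (hz : Even z) : sign z = 1 := by
  obtain ⟨m, rfl⟩ := hz
  rw [sign, ← Complex.exp_int_mul_two_pi_mul_I m]
  congr 1
  push_cast
  ring

lemma sign_odd {z : ℤ} (hz : Odd z) : sign z = -1 := by
  obtain ⟨m, rfl⟩ := hz
  have : Complex.I * Real.pi * ((2 * m + 1 : ℤ) : ℂ) =
      Real.pi * Complex.I + m * (2 * Real.pi * Complex.I) := by push_cast; ring
  rw [sign, this, Complex.exp_add, Complex.exp_pi_mul_I, Complex.exp_int_mul_two_pi_mul_I, mul_one]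

lemma sign_add (z w : ℤ) : sign (z + w) = sign z * sign w := by
  rw [sign, sign, sign, ← Complex.exp_add]
  push_cast
  ring_nf

lemma sign_sum {m : ℕ} (f : Fin m → ℤ) : sign (∑ i, f i) = ∏ i, sign (f i) := by
  simp only [sign, ← Complex.exp_sum, Int.cast_sum, Finset.mul_sum]

/-- Orthogonality of the characters of `(ℤ/2)^m`: the sum factors, and an odd coordinate contributes
`1 + (-1)`. -/
lemma sum_sign_dotProduct {m : ℕ} (v : Fin m → ℤ) [Decidable (∀ j, Even (v j))] :
    ∑ γ ∈ cubeVertices m, sign (v ⬝ᵥ γ) = if ∀ j, Even (v j) then 2 ^ m else 0 := by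
  simp only [dotProduct, sign_sum]
  rw [sum_cubeVertices_prod fun j x => sign (v j * x)]
  simp only [mul_zero, mul_one, sign_even (Even.zero)]
  split_ifs with h
  · simp only [sign_even (h _)]
    norm_num
  · push Not at h
    obtain ⟨j, hj⟩ := h
    refine Finset.prod_eq_zero (Finset.mem_univ j) ?_
    rw [sign_odd (Int.not_even_iff_odd.1 hj), add_neg_cancel]

/-- Each residue class modulo `2` is hit by equally many projected vertices of the cube. -/
lemma two_pow_mul_card_filter {d n : ℕ} (P : Matrix (Fin d) (Fin n) ℤ)
    (hP : Set.MapsTo (fun k : Fin d → ℤ => Pᵀ *ᵥ k) (evenLattice d)ᶜ (evenLattice n)ᶜ)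
    (q : Fin d → ℤ) :
    2 ^ d * ((cubeVertices n).filter fun γ => ∀ i, Even ((q - P *ᵥ γ) i)).card = 2 ^ n := by
  classical
  -- The congruence `q ≡ Pγ` modulo `2` is detected by summing signs over `ω`. After exchanging the
  -- sums, the parity hypothesis leaves only `ω = 0`.
  have h1 : ((2 ^ d * ((cubeVertices n).filter fun γ => ∀ i, Even ((q - P *ᵥ γ) i)).card : ℕ) : ℂ) =
      ∑ γ ∈ cubeVertices n, ∑ ω ∈ cubeVertices d, sign ((q - P *ᵥ γ) ⬝ᵥ ω) := by
    simp only [sum_sign_dotProduct]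
    rw [← Finset.sum_filter, Finset.sum_const, nsmul_eq_mul]
    push_cast
    ring
  have h2 (γ : Fin n → ℤ) (ω : Fin d → ℤ) : sign ((q - P *ᵥ γ) ⬝ᵥ ω) =
      sign (q ⬝ᵥ ω) * sign ((-(Pᵀ *ᵥ ω)) ⬝ᵥ γ) := by
    rw [← sign_add]
    congr 1
    rw [sub_dotProduct, neg_dotProduct, sub_eq_add_neg, Matrix.mulVec_transpose,
      ← Matrix.dotProduct_mulVec, dotProduct_comm ω]
  have h3 : ∑ γ ∈ cubeVertices n, ∑ ω ∈ cubeVertices d, sign ((q - P *ᵥ γ) ⬝ᵥ ω) = 2 ^ n := by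
    simp only [h2]
    rw [Finset.sum_comm]
    simp only [← Finset.mul_sum, sum_sign_dotProduct]
    have h0 : (0 : Fin d → ℤ) ∈ cubeVertices d := by simp [cubeVertices]
    rw [Finset.sum_eq_single_of_mem 0 h0]
    · simp [sign]
    · intro ω hω hne
      obtain ⟨j, hj⟩ := odd_of_not_mem_evenLattice
        (hP (not_mem_evenLattice_of_mem_cubeVertices hω hne))
      rw [if_neg, mul_zero]
      intro h
      exact Int.not_even_iff_odd.2 hj (by simpa using h j)
  exact_mod_cast h1.trans h3

/-- Writing a coset sum as a sum over all of `ℤ^d` with an indicator lets the cosets of different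
`γ` be merged. -/
lemma tsum_two_smul_add {d : ℕ} (g : (Fin d → ℤ) → ℝ≥0∞) (r : Fin d → ℤ)
    [∀ q : Fin d → ℤ, Decidable (∀ i, Even ((q - r) i))] :
    ∑' k : Fin d → ℤ, g ((2 : ℤ) • k + r) =
      ∑' q : Fin d → ℤ, if ∀ i, Even ((q - r) i) then g q else 0 := by
  have hinj : Function.Injective fun k : Fin d → ℤ => (2 : ℤ) • k + r := by
    intro k l h
    ext i
    have := congrFun h i
    simp only [Pi.add_apply, Pi.smul_apply, smul_eq_mul] at this
    omega
  rw [← hinj.tsum_eq (f := fun q : Fin d → ℤ => if ∀ i, Even ((q - r) i) then g q else 0)]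
  · refine tsum_congr fun k => ?_
    rw [if_pos]
    intro i
    simp
  · intro q hq
    have : ∀ i, Even ((q - r) i) := by
      by_contra h
      exact hq (if_neg h)
    choose m hm using this
    refine ⟨m, ?_⟩
    ext i
    have := hm i
    simp only [Pi.sub_apply, Pi.add_apply, Pi.smul_apply, smul_eq_mul] at this ⊢
    omega

/-- Averages over the projected vertices of the cube and even translates. -/
theorem sum_tsum_two_smul_add {d n : ℕ} (P : Matrix (Fin d) (Fin n) ℤ)
    (hP : Set.MapsTo (fun k : Fin d → ℤ => Pᵀ *ᵥ k) (evenLattice d)ᶜ (evenLattice n)ᶜ)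
    (g : (Fin d → ℤ) → ℝ≥0∞) :
    2 ^ d * ∑ γ ∈ cubeVertices n, ∑' k : Fin d → ℤ, g ((2 : ℤ) • k + P *ᵥ γ) =
      2 ^ n * ∑' q, g q := by
  classical
  simp only [tsum_two_smul_add]
  rw [← Summable.tsum_finsetSum fun _ _ => ENNReal.summable, ← ENNReal.tsum_mul_left,
    ← ENNReal.tsum_mul_left]
  refine tsum_congr fun q => ?_
  rw [← Finset.sum_filter, Finset.sum_const, nsmul_eq_mul, ← mul_assoc]
  congr 1
  exact_mod_cast two_pow_mul_card_filter P hP q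

/-! ### The energy of the framelet coefficients at a given level -/

/-- The dilated translate `2^{jd/2} g(2^j x - k)`. -/
noncomputable def atom {d : ℕ} (g : E d → ℂ) (j : ℕ) (k : Fin d → ℤ) (x : E d) : ℂ :=
  (((2 : ℝ) ^ ((j : ℝ) * d / 2) : ℝ) : ℂ) * g (((2 : ℝ) ^ j) • x - pt k)

lemma IsBoundedCompact.atom {d : ℕ} {g : E d → ℂ} (hg : IsBoundedCompact g) (j : ℕ)
    (k : Fin d → ℤ) : IsBoundedCompact (atom g j k) :=
  (hg.comp_smul_sub (pow_ne_zero j two_ne_zero) (pt k)).smul _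

/-- The sum `∑ₖ |⟨f, 2^{jd/2} g(2^j · - k)⟩|²`. -/
noncomputable def levelEnergy {d : ℕ} (f g : E d → ℂ) (j : ℕ) : ℝ≥0∞ :=
  ∑' k : Fin d → ℤ, ‖pairing f (atom g j k)‖ₑ ^ 2

lemma levelEnergy_zero {d : ℕ} (f g : E d → ℂ) :
    levelEnergy f g 0 = ∑' k : Fin d → ℤ, ‖pairing f fun x => g (x - pt k)‖ₑ ^ 2 := by
  have (k : Fin d → ℤ) : atom g 0 k = fun x => g (x - pt k) := by
    ext x
    simp [atom]
  simp only [levelEnergy, this]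

lemma pt_add {d : ℕ} (k l : Fin d → ℤ) : pt (k + l) = pt k + pt l := by
  ext i
  simp [pt]

lemma pt_two_smul {d : ℕ} (k : Fin d → ℤ) : pt ((2 : ℤ) • k) = (2 : ℝ) • pt k := by
  ext i
  simp [pt]

/-- Here `2(2^j x - k) - m = 2^{j+1} x - (2k + m)`, and the exponents balance: `jd/2 + d = d/2 +
(j+1)d/2`. -/
lemma atom_scale {d : ℕ} (g : E d → ℂ) (j : ℕ) (k m : Fin d → ℤ) (x : E d) :
    (((2 : ℝ) ^ ((j : ℝ) * d / 2) : ℝ) : ℂ) * ((2 : ℂ) ^ d *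
      g ((2 : ℝ) • (((2 : ℝ) ^ j) • x - pt k) - pt m)) =
    (((2 : ℝ) ^ ((d : ℝ) / 2) : ℝ) : ℂ) * atom g (j + 1) ((2 : ℤ) • k + m) x := by
  have h1 : (2 : ℝ) • (((2 : ℝ) ^ j) • x - pt k) - pt m =
      ((2 : ℝ) ^ (j + 1)) • x - pt ((2 : ℤ) • k + m) := by
    rw [pt_add, pt_two_smul, smul_sub, smul_smul, pow_succ', sub_sub]
  have h2 : (2 : ℝ) ^ ((j : ℝ) * d / 2) * (2 : ℝ) ^ d =
      (2 : ℝ) ^ ((d : ℝ) / 2) * (2 : ℝ) ^ (((j + 1 : ℕ) : ℝ) * d / 2) := by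
    rw [← Real.rpow_natCast, ← Real.rpow_add two_pos, ← Real.rpow_add two_pos]
    congr 1
    push_cast
    ring
  rw [atom, ← h1, ← mul_assoc, ← mul_assoc]
  congr 1
  exact_mod_cast h2

/-- The normalization `2^{d/2} 2^{-n}` of the decomposition filters. -/
noncomputable def cascadeFactor (d n : ℕ) : ℝ := (2 : ℝ) ^ ((d : ℝ) / 2) * ((2 : ℝ) ^ n)⁻¹

lemma atom_subdivide_haarLowPass {d n : ℕ} (P : Matrix (Fin d) (Fin n) ℤ) (g : E d → ℂ) (j : ℕ)
    (k : Fin d → ℤ) (x : E d) : atom (subdivide (project P (haarLowPass n)) g) j k x =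
      cascadeFactor d n * ∑ γ ∈ cubeVertices n, atom g (j + 1) ((2 : ℤ) • k + P *ᵥ γ) x := by
  rw [atom, subdivide_project_haarLowPass, Finset.mul_sum, Finset.mul_sum, Finset.mul_sum]
  refine Finset.sum_congr rfl fun γ _ => ?_
  have := atom_scale g j k (P *ᵥ γ) x
  rw [cascadeFactor]
  push_cast at this ⊢
  linear_combination ((2 : ℂ) ^ n)⁻¹ * this

lemma atom_subdivide_haarHighPass {d n : ℕ} (P : Matrix (Fin d) (Fin n) ℤ)
    (e : (Fin n → ℤ) × (Fin n → ℤ)) (g : E d → ℂ) (j : ℕ) (k : Fin d → ℤ) (x : E d) :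
    atom (subdivide (project P (haarHighPass e)) g) j k x = cascadeFactor d n *
      (atom g (j + 1) ((2 : ℤ) • k + P *ᵥ e.1) x - atom g (j + 1) ((2 : ℤ) • k + P *ᵥ e.2) x) := by
  rw [atom, subdivide_project_haarHighPass]
  have h1 := atom_scale g j k (P *ᵥ e.1) x
  have h2 := atom_scale g j k (P *ᵥ e.2) x
  rw [cascadeFactor]
  push_cast at h1 h2 ⊢
  linear_combination ((2 : ℂ) ^ n)⁻¹ * (h1 - h2)

lemma integrable_mul_conj {d : ℕ} {f g : E d → ℂ} (hf : MemLp f 2) (hg : MemLp g 2) :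
    Integrable fun x => f x * conj (g x) :=
  hf.integrable_mul hg.star

lemma pairing_subdivide_haarLowPass {d n : ℕ} (P : Matrix (Fin d) (Fin n) ℤ) {f g : E d → ℂ}
    (hf : MemLp f 2) (hg : IsBoundedCompact g) (j : ℕ) (k : Fin d → ℤ) :
    pairing f (atom (subdivide (project P (haarLowPass n)) g) j k) = cascadeFactor d n *
      ∑ γ ∈ cubeVertices n, pairing f (atom g (j + 1) ((2 : ℤ) • k + P *ᵥ γ)) := by
  simp only [pairing]
  rw [← integral_finsetSum _ fun γ _ => integrable_mul_conj hf ((hg.atom _ _).memLp 2),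
    ← integral_const_mul]
  congr 1 with x
  rw [atom_subdivide_haarLowPass, map_mul, Complex.conj_ofReal, map_sum, ← Finset.mul_sum]
  ring

lemma pairing_subdivide_haarHighPass {d n : ℕ} (P : Matrix (Fin d) (Fin n) ℤ)
    (e : (Fin n → ℤ) × (Fin n → ℤ)) {f g : E d → ℂ}
    (hf : MemLp f 2) (hg : IsBoundedCompact g) (j : ℕ) (k : Fin d → ℤ) :
    pairing f (atom (subdivide (project P (haarHighPass e)) g) j k) = cascadeFactor d n *
      (pairing f (atom g (j + 1) ((2 : ℤ) • k + P *ᵥ e.1)) -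
        pairing f (atom g (j + 1) ((2 : ℤ) • k + P *ᵥ e.2))) := by
  simp only [pairing]
  rw [← integral_sub (integrable_mul_conj hf ((hg.atom _ _).memLp 2))
    (integrable_mul_conj hf ((hg.atom _ _).memLp 2)), ← integral_const_mul]
  congr 1 with x
  rw [atom_subdivide_haarHighPass, map_mul, Complex.conj_ofReal, map_sub]
  ring

/-- Needed because the refinement equation for `φ` is only known almost everywhere; the affine
substitution preserves null sets. -/
lemma pairing_atom_congr {d : ℕ} (f : E d → ℂ) {g h : E d → ℂ} (hgh : g =ᵐ[volume] h) (j : ℕ)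
    (k : Fin d → ℤ) : pairing f (atom g j k) = pairing f (atom h j k) := by
  have hq : Measure.QuasiMeasurePreserving (fun x : E d => ((2 : ℝ) ^ j) • x - pt k) :=
    (measurePreserving_sub_right volume (pt k)).quasiMeasurePreserving.comp
      (Measure.quasiMeasurePreserving_smul volume (pow_ne_zero j two_ne_zero))
  refine integral_congr_ae ?_
  filter_upwards [hq.ae hgh] with x hx
  rw [atom, atom, hx]

/-- The variance identity on the edges of the cube, for squared norms. -/
lemma IsEdgeEnumeration.enorm_sq_sum {n s : ℕ} {e : Fin s → (Fin n → ℤ) × (Fin n → ℤ)}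
    (he : IsEdgeEnumeration e) (z : (Fin n → ℤ) → ℂ) :
    ‖∑ γ ∈ cubeVertices n, z γ‖ₑ ^ 2 + ∑ l, ‖z (e l).1 - z (e l).2‖ₑ ^ 2 =
      2 ^ n * ∑ γ ∈ cubeVertices n, ‖z γ‖ₑ ^ 2 := by
  have h : ‖∑ γ ∈ cubeVertices n, z γ‖ ^ 2 + ∑ l, ‖z (e l).1 - z (e l).2‖ ^ 2 =
      2 ^ n * ∑ γ ∈ cubeVertices n, ‖z γ‖ ^ 2 := by
    have := he.sum_mul_conj_sum z z
    simp only [Complex.mul_conj'] at this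
    exact_mod_cast this
  have h2 (w : ℂ) : ‖w‖ₑ ^ 2 = ENNReal.ofReal (‖w‖ ^ 2) := by
    rw [ENNReal.ofReal_pow (norm_nonneg _), ofReal_norm]
  have h3 : (2 : ℝ≥0∞) ^ n = ENNReal.ofReal (2 ^ n) := by
    rw [ENNReal.ofReal_pow two_pos.le]
    norm_num
  simp only [h2]
  rw [h3, ← ENNReal.ofReal_sum_of_nonneg fun _ _ => by positivity,
    ← ENNReal.ofReal_sum_of_nonneg fun _ _ => by positivity,
    ← ENNReal.ofReal_mul (by positivity), ← ENNReal.ofReal_add (by positivity) (by positivity), h]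

/-- One factor `2 ^ n` comes from the variance identity and one from the residue count; the result
matches the `2 ^ d` in `sum_tsum_two_smul_add`. -/
lemma enorm_cascadeFactor_sq (d n : ℕ) :
    2 ^ n * (2 ^ n * ‖(cascadeFactor d n : ℂ)‖ₑ ^ 2) = (2 : ℝ≥0∞) ^ d := by
  have h0 : 0 ≤ cascadeFactor d n := by rw [cascadeFactor]; positivity
  have h : 2 ^ n * (2 ^ n * cascadeFactor d n ^ 2) = 2 ^ d := by
    have : ((2 : ℝ) ^ ((d : ℝ) / 2)) ^ 2 = 2 ^ d := by
      rw [← Real.rpow_natCast, ← Real.rpow_mul two_pos.le, ← Real.rpow_natCast]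
      congr 1
      push_cast
      ring
    rw [cascadeFactor, mul_pow, this]
    field_simp
  have h3 (m : ℕ) : (2 : ℝ≥0∞) ^ m = ENNReal.ofReal (2 ^ m) := by
    rw [ENNReal.ofReal_pow two_pos.le]
    norm_num
  have h4 : ‖(cascadeFactor d n : ℂ)‖ₑ = ENNReal.ofReal (cascadeFactor d n) := by
    rw [← ofReal_norm, Complex.norm_of_nonneg h0]
  rw [h4, h3, h3, ← ENNReal.ofReal_pow h0, ← ENNReal.ofReal_mul (by positivity),
    ← ENNReal.ofReal_mul (by positivity), h]

/-- One step of the framelet decomposition preserves energy. -/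
theorem levelEnergy_succ {d n s : ℕ} (P : Matrix (Fin d) (Fin n) ℤ)
    (hP : Set.MapsTo (fun k : Fin d → ℤ => Pᵀ *ᵥ k) (evenLattice d)ᶜ (evenLattice n)ᶜ)
    {e : Fin s → (Fin n → ℤ) × (Fin n → ℤ)} (he : IsEdgeEnumeration e) {f g : E d → ℂ}
    (hf : MemLp f 2) (hg : IsBoundedCompact g)
    (hgr : g =ᵐ[volume] subdivide (project P (haarLowPass n)) g) (j : ℕ) :
    levelEnergy f g (j + 1) = levelEnergy f g j +
      ∑ l, levelEnergy f (subdivide (project P (haarHighPass (e l))) g) j := by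
  set c : (Fin d → ℤ) → ℂ := fun q => pairing f (atom g (j + 1) q) with hc
  -- For fixed `k` this is the variance identity for the numbers `c (2k + Pγ)`.
  have key (k : Fin d → ℤ) : ‖pairing f (atom g j k)‖ₑ ^ 2 +
      ∑ l, ‖pairing f (atom (subdivide (project P (haarHighPass (e l))) g) j k)‖ₑ ^ 2 =
      ‖(cascadeFactor d n : ℂ)‖ₑ ^ 2 *
        (2 ^ n * ∑ γ ∈ cubeVertices n, ‖c ((2 : ℤ) • k + P *ᵥ γ)‖ₑ ^ 2) := by
    rw [← he.enorm_sq_sum fun γ => c ((2 : ℤ) • k + P *ᵥ γ), mul_add, Finset.mul_sum,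
      pairing_atom_congr f hgr, pairing_subdivide_haarLowPass P hf hg]
    simp only [pairing_subdivide_haarHighPass P _ hf hg, enorm_mul, mul_pow, hc]
  have h1 : levelEnergy f g j +
      ∑ l, levelEnergy f (subdivide (project P (haarHighPass (e l))) g) j =
      ‖(cascadeFactor d n : ℂ)‖ₑ ^ 2 * (2 ^ n *
        ∑ γ ∈ cubeVertices n, ∑' k : Fin d → ℤ, ‖c ((2 : ℤ) • k + P *ᵥ γ)‖ₑ ^ 2) := by
    simp only [levelEnergy]
    rw [← Summable.tsum_finsetSum fun _ _ => ENNReal.summable, ← ENNReal.tsum_add,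
      ← Summable.tsum_finsetSum fun _ _ => ENNReal.summable, ← ENNReal.tsum_mul_left,
      ← ENNReal.tsum_mul_left]
    exact tsum_congr key
  have h2 := sum_tsum_two_smul_add P hP fun q => ‖c q‖ₑ ^ 2
  have h0 : (2 : ℝ≥0∞) ^ n ≠ 0 := pow_ne_zero _ two_ne_zero
  have htop : (2 : ℝ≥0∞) ^ n ≠ ∞ := ENNReal.pow_ne_top ENNReal.ofNat_ne_top
  refine (ENNReal.mul_right_inj h0 htop).1 ?_
  rw [h1]
  calc 2 ^ n * levelEnergy f g (j + 1) = 2 ^ d * ∑ γ ∈ cubeVertices n,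
        ∑' k : Fin d → ℤ, ‖c ((2 : ℤ) • k + P *ᵥ γ)‖ₑ ^ 2 := h2.symm
    _ = _ := by
      rw [← enorm_cascadeFactor_sq d n]
      ring

end BoxSpline

/-! ### Tight frames from nested energies -/

section Hilbert

open Filter Topology

variable {H ι : Type*} [NormedAddCommGroup H] [InnerProductSpace ℂ H]

/-- Minkowski's inequality in `ℓ²`, read off from `eLpNorm` for the counting measure. -/
lemma rpow_tsum_enorm_inner_sub_le (v : ι → H) (F G : H) :
    (∑' k, ‖inner ℂ (v k) F‖ₑ ^ 2) ^ (2⁻¹ : ℝ) ≤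
      (∑' k, ‖inner ℂ (v k) G‖ₑ ^ 2) ^ (2⁻¹ : ℝ) +
        (∑' k, ‖inner ℂ (v k) (F - G)‖ₑ ^ 2) ^ (2⁻¹ : ℝ) := by
  let _ : MeasurableSpace ι := ⊤
  have h (K : H) : (∑' k, ‖inner ℂ (v k) K‖ₑ ^ 2) ^ (2⁻¹ : ℝ) =
      eLpNorm (fun k => inner ℂ (v k) K) 2 Measure.count := by
    rw [eLpNorm_eq_lintegral_rpow_enorm_toReal two_ne_zero ENNReal.ofNat_ne_top, lintegral_count]
    simp
  rw [h, h, h]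
  refine le_trans (le_of_eq ?_) (eLpNorm_add_le (μ := Measure.count)
    (f := fun k => inner ℂ (v k) G) (g := fun k => inner ℂ (v k) (F - G))
    measurable_from_top.aestronglyMeasurable measurable_from_top.aestronglyMeasurable
    one_le_two)
  congr 1
  ext k
  simp

/-- If the energies of the levels are increasing and converge to the squared norm on a dense set,
then they do so everywhere. -/
theorem tendsto_tsum_enorm_inner_of_dense (v : ℕ → ι → H)
    (hmono : ∀ F, Monotone fun J => ∑' k, ‖inner ℂ (v J k) F‖ₑ ^ 2) {D : Set H} (hD : Dense D)
    (hlim : ∀ F ∈ D, Tendsto (fun J => ∑' k, ‖inner ℂ (v J k) F‖ₑ ^ 2) atTop (𝓝 (‖F‖ₑ ^ 2)))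
    (F : H) : Tendsto (fun J => ∑' k, ‖inner ℂ (v J k) F‖ₑ ^ 2) atTop (𝓝 (‖F‖ₑ ^ 2)) := by
  -- On `D` a monotone sequence stays below its limit. Finite partial sums are continuous, so this
  -- Bessel bound passes to the closure of `D`.
  have bound (J : ℕ) (G : H) : ∑' k, ‖inner ℂ (v J k) G‖ₑ ^ 2 ≤ ‖G‖ₑ ^ 2 := by
    rw [ENNReal.tsum_eq_iSup_sum]
    refine iSup_le fun s => ?_
    have hcl : IsClosed {G : H | ∑ k ∈ s, ‖inner ℂ (v J k) G‖ₑ ^ 2 ≤ ‖G‖ₑ ^ 2} := by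
      refine isClosed_le (continuous_finsetSum _ fun k _ => ?_) ?_
      · exact (ENNReal.continuous_pow 2).comp (Continuous.enorm (by fun_prop))
      · exact (ENNReal.continuous_pow 2).comp continuous_enorm
    have hsub : D ⊆ {G : H | ∑ k ∈ s, ‖inner ℂ (v J k) G‖ₑ ^ 2 ≤ ‖G‖ₑ ^ 2} := fun G hG =>
      (ENNReal.sum_le_tsum s).trans ((hmono G).ge_of_tendsto (hlim G hG) J)
    exact hcl.closure_subset_iff.2 hsub (hD G)
  set S := ⨆ J, ∑' k, ‖inner ℂ (v J k) F‖ₑ ^ 2 with hS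
  have hSlim := tendsto_atTop_iSup (hmono F)
  have hSle : S ≤ ‖F‖ₑ ^ 2 := iSup_le fun J => bound J F
  have hsq (a : ℝ≥0∞) : (a ^ 2) ^ (2⁻¹ : ℝ) = a := by
    rw [← ENNReal.rpow_natCast, ← ENNReal.rpow_mul]
    norm_num
  -- No norm is lost in the limit: approximate `F` by `G` in `D`, and control the energy of `G - F`
  -- uniformly in `J` by the Bessel bound.
  have hle : ‖F‖ₑ ≤ S ^ (2⁻¹ : ℝ) := by
    refine ENNReal.le_of_forall_pos_le_add fun ε hε _ => ?_
    obtain ⟨G, hG, hFG⟩ := hD.exists_dist_lt F (ε := ε / 2) (by positivity)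
    have hFG' : ‖F - G‖ₑ ≤ (ε / 2 : NNReal) := by
      rw [← ofReal_norm, ← dist_eq_norm]
      exact ENNReal.ofReal_le_of_le_toReal (by simpa using hFG.le)
    have hG' : ‖G‖ₑ ≤ S ^ (2⁻¹ : ℝ) + (ε / 2 : NNReal) := by
      have h1 : Tendsto (fun J => (∑' k, ‖inner ℂ (v J k) G‖ₑ ^ 2) ^ (2⁻¹ : ℝ)) atTop
          (𝓝 ‖G‖ₑ) := by
        have := (ENNReal.continuous_rpow_const (y := 2⁻¹)).tendsto (‖G‖ₑ ^ 2) |>.comp (hlim G hG)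
        rwa [hsq] at this
      have h2 := ((ENNReal.continuous_rpow_const (y := 2⁻¹)).tendsto S |>.comp hSlim).add_const
        ((ε / 2 : NNReal) : ℝ≥0∞)
      refine le_of_tendsto_of_tendsto' h1 h2 fun J => ?_
      refine (rpow_tsum_enorm_inner_sub_le (v J) G F).trans (add_le_add le_rfl ?_)
      refine (ENNReal.rpow_le_rpow (bound J (G - F)) (by norm_num)).trans ?_
      rw [hsq, ← neg_sub, enorm_neg]
      exact hFG'
    calc ‖F‖ₑ = ‖G + (F - G)‖ₑ := by rw [add_sub_cancel]
      _ ≤ ‖G‖ₑ + ‖F - G‖ₑ := enorm_add_le _ _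
      _ ≤ S ^ (2⁻¹ : ℝ) + (ε / 2 : NNReal) + (ε / 2 : NNReal) := add_le_add hG' hFG'
      _ = S ^ (2⁻¹ : ℝ) + ε := by
        rw [add_assoc, ← ENNReal.coe_add, add_halves]
  have hFS : ‖F‖ₑ ^ 2 ≤ S := by
    calc ‖F‖ₑ ^ 2 ≤ (S ^ (2⁻¹ : ℝ)) ^ 2 := by gcongr
      _ = S := by
        rw [← ENNReal.rpow_natCast, ← ENNReal.rpow_mul]
        norm_num
  rw [le_antisymm hFS hSle]
  exact hSlim

end Hilbert

namespace BoxSpline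

open Filter Topology

/-! ### Energies of continuous functions with compact support -/

/-- The coordinatewise floor of a point of `ℝ^d`. -/
noncomputable def floorPt {d : ℕ} (x : E d) : Fin d → ℤ := fun i => ⌊x i⌋

lemma measurable_floorPt {d : ℕ} : Measurable (floorPt : E d → Fin d → ℤ) :=
  measurable_pi_lambda _ fun i => Int.measurable_floor.comp (by fun_prop)

/-- The half-open unit cubes at lattice points tile `ℝ^d` with volume one, so lattice series become
integrals of step functions. -/
lemma map_floorPt (d : ℕ) : (volume : Measure (E d)).map floorPt = Measure.count := by
  refine Measure.ext_of_singleton fun k => ?_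
  rw [Measure.map_apply measurable_floorPt (measurableSet_singleton k), Measure.count_singleton]
  have h : (floorPt ⁻¹' {k} : Set (E d)) =
      WithLp.ofLp ⁻¹' (Set.univ.pi fun i => Set.Ico (k i : ℝ) (k i + 1)) := by
    ext x
    simp only [Set.mem_preimage, Set.mem_singleton_iff, funext_iff, floorPt, Int.floor_eq_iff,
      Set.mem_pi, Set.mem_univ, true_imp_iff, Set.mem_Ico]
  rw [h, (PiLp.volume_preserving_ofLp (Fin d)).measure_preimage
    (MeasurableSet.univ_pi fun i => measurableSet_Ico).nullMeasurableSet, volume_pi_pi]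
  simp

lemma tsum_eq_lintegral_floorPt {d : ℕ} (h : (Fin d → ℤ) → ℝ≥0∞) :
    ∑' k, h k = ∫⁻ x : E d, h (floorPt x) := by
  rw [← lintegral_count, ← map_floorPt, lintegral_map (measurable_of_countable h)
    measurable_floorPt]

lemma lintegral_comp_smul {d : ℕ} {F : E d → ℝ≥0∞} (hF : Measurable F) {r : ℝ} (hr : 0 < r) :
    ENNReal.ofReal (r ^ d) * ∫⁻ x, F (r • x) = ∫⁻ x, F x := by
  rw [← lintegral_map hF (measurable_const_smul r), Measure.map_addHaar_smul _ hr.ne',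
    lintegral_smul_measure, finrank_euclideanSpace_fin, smul_eq_mul, ← mul_assoc,
    ← ENNReal.ofReal_mul (by positivity), abs_of_pos (by positivity),
    mul_inv_cancel₀ (by positivity), ENNReal.ofReal_one, one_mul]

lemma norm_pt_floorPt_sub_le {d : ℕ} (x : E d) : ‖pt (floorPt x) - x‖ ≤ √d := by
  rw [EuclideanSpace.norm_eq]
  refine Real.sqrt_le_sqrt ?_
  calc ∑ i, ‖(pt (floorPt x) - x) i‖ ^ 2 ≤ ∑ _i : Fin d, (1 : ℝ) := by
        refine Finset.sum_le_sum fun i _ => ?_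
        have h1 := Int.floor_le (x i)
        have h2 := Int.lt_floor_add_one (x i)
        have : (pt (floorPt x) - x) i = ⌊x i⌋ - x i := rfl
        rw [this, Real.norm_eq_abs, sq_abs]
        nlinarith
    _ = d := by simp

/-- The average of `f` at scale `2^{-J}` near `x`, weighted by `φ`. -/
noncomputable def quasiInterpolant {d : ℕ} (f φ : E d → ℂ) (J : ℕ) (x : E d) : ℂ :=
  ∫ y, f (((2 : ℝ) ^ J)⁻¹ • (y + pt (floorPt (((2 : ℝ) ^ J) • x)))) * conj (φ y)

/-- Substitute `x = 2^{-J}(y + k)`: the extra prefactor and the atom's normalization together cancel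
the Jacobian. -/
lemma scaled_pairing_atom {d : ℕ} (f φ : E d → ℂ) (J : ℕ) (k : Fin d → ℤ) :
    (((2 : ℝ) ^ ((J : ℝ) * d / 2) : ℝ) : ℂ) * pairing f (atom φ J k) =
      ∫ y, f (((2 : ℝ) ^ J)⁻¹ • (y + pt k)) * conj (φ y) := by
  have h2 : (0 : ℝ) < 2 ^ J := by positivity
  let F : E d → ℂ := fun y => f (((2 : ℝ) ^ J)⁻¹ • y) * conj (φ (y - pt k))
  have h1 : ∫ y, f (((2 : ℝ) ^ J)⁻¹ • (y + pt k)) * conj (φ y) = ∫ y, F y := by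
    rw [← integral_add_right_eq_self F (pt k)]
    simp only [F, add_sub_cancel_right]
  have h3 : ∫ x, F (((2 : ℝ) ^ J) • x) = ((((2 : ℝ) ^ J) ^ d)⁻¹ : ℝ) • ∫ y, F y := by
    rw [Measure.integral_comp_smul, finrank_euclideanSpace_fin, abs_of_pos (by positivity)]
  have h4 : ∫ y, F y = ((((2 : ℝ) ^ J) ^ d : ℝ) : ℂ) * ∫ x, F (((2 : ℝ) ^ J) • x) := by
    rw [h3, Complex.real_smul, ← mul_assoc, ← Complex.ofReal_mul,
      mul_inv_cancel₀ (by positivity), Complex.ofReal_one, one_mul]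
  have h5 : (2 : ℝ) ^ ((J : ℝ) * d / 2) * (2 : ℝ) ^ ((J : ℝ) * d / 2) = ((2 : ℝ) ^ J) ^ d := by
    rw [← Real.rpow_add two_pos, add_halves, Real.rpow_mul two_pos.le, Real.rpow_natCast,
      Real.rpow_natCast]
  have h6 : pairing f (atom φ J k) =
      (((2 : ℝ) ^ ((J : ℝ) * d / 2) : ℝ) : ℂ) * ∫ x, F (((2 : ℝ) ^ J) • x) := by
    rw [pairing, ← integral_const_mul]
    congr 1 with x
    simp only [F, atom, map_mul, Complex.conj_ofReal, smul_smul, inv_mul_cancel₀ h2.ne', one_smul]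
    ring
  rw [h1, h4, h6, ← h5, Complex.ofReal_mul, mul_assoc]

/-- With the energy written as an integral over `ℝ^d`, its limit is accessible to dominated
convergence. -/
lemma levelEnergy_eq_lintegral {d : ℕ} (f φ : E d → ℂ) (J : ℕ) :
    levelEnergy f φ J = ∫⁻ x, ‖quasiInterpolant f φ J x‖ₑ ^ 2 := by
  have h2 : (0 : ℝ) < 2 ^ J := by positivity
  have hm : Measurable fun x : E d => ‖pairing f (atom φ J (floorPt x))‖ₑ ^ 2 :=
    (measurable_of_countable fun k : Fin d → ℤ => ‖pairing f (atom φ J k)‖ₑ ^ 2).comp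
      measurable_floorPt
  rw [levelEnergy, tsum_eq_lintegral_floorPt, ← lintegral_comp_smul hm h2,
    ← lintegral_const_mul _ (f := fun x : E d =>
      ‖pairing f (atom φ J (floorPt (((2 : ℝ) ^ J) • x)))‖ₑ ^ 2)
      (hm.comp (measurable_const_smul _))]
  refine lintegral_congr fun x => ?_
  have h5 : ((2 : ℝ) ^ ((J : ℝ) * d / 2)) ^ 2 = ((2 : ℝ) ^ J) ^ d := by
    rw [sq, ← Real.rpow_add two_pos, add_halves, Real.rpow_mul two_pos.le, Real.rpow_natCast,
      Real.rpow_natCast]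
  rw [quasiInterpolant, ← scaled_pairing_atom, enorm_mul, mul_pow]
  congr 1
  rw [← ofReal_norm, Complex.norm_of_nonneg (by positivity), ← ENNReal.ofReal_pow (by positivity),
    h5]

lemma measurable_quasiInterpolant {d : ℕ} (f φ : E d → ℂ) (J : ℕ) :
    Measurable (quasiInterpolant f φ J) :=
  (measurable_of_countable fun k : Fin d → ℤ =>
    ∫ y, f (((2 : ℝ) ^ J)⁻¹ • (y + pt k)) * conj (φ y)).comp
      (measurable_floorPt.comp (measurable_const_smul _))

/-- This closeness of the sampling nodes to `x` gives both pointwise convergence and a bounded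
support common to all `J`. -/
lemma norm_node_sub_le {d : ℕ} (J : ℕ) (x y : E d) :
    ‖((2 : ℝ) ^ J)⁻¹ • (y + pt (floorPt (((2 : ℝ) ^ J) • x))) - x‖ ≤
      ((2 : ℝ) ^ J)⁻¹ * (‖y‖ + √d) := by
  have h2 : (0 : ℝ) < 2 ^ J := by positivity
  have h : ((2 : ℝ) ^ J)⁻¹ • (y + pt (floorPt (((2 : ℝ) ^ J) • x))) - x =
      ((2 : ℝ) ^ J)⁻¹ • (y + (pt (floorPt (((2 : ℝ) ^ J) • x)) - ((2 : ℝ) ^ J) • x)) := by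
    rw [← add_sub_assoc, smul_sub, smul_smul, inv_mul_cancel₀ h2.ne', one_smul]
  rw [h, norm_smul, norm_inv, Real.norm_of_nonneg h2.le]
  gcongr
  exact (norm_add_le _ _).trans (add_le_add le_rfl (norm_pt_floorPt_sub_le _))

lemma tendsto_quasiInterpolant {d : ℕ} {f φ : E d → ℂ} (hf : Continuous f)
    (hfc : HasCompactSupport f) (hφ : IsBoundedCompact φ) (hφ1 : ∫ x, φ x = 1) (x : E d) :
    Tendsto (fun J => quasiInterpolant f φ J x) atTop (𝓝 (f x)) := by
  obtain ⟨M, hM⟩ := hf.bounded_above_of_compact_support hfc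
  have hlim : f x = ∫ y, f x * conj (φ y) := by
    rw [integral_const_mul, integral_conj, hφ1, map_one, mul_one]
  rw [hlim]
  refine tendsto_integral_of_dominated_convergence (fun y => M * ‖φ y‖) (fun J => ?_)
    (hφ.integrable.norm.const_mul M) (fun J => .of_forall fun y => ?_) (.of_forall fun y => ?_)
  · exact ((hf.comp (by fun_prop)).measurable.mul
      (Complex.continuous_conj.measurable.comp hφ.measurable)).aestronglyMeasurable
  · rw [norm_mul, RCLike.norm_conj]
    exact mul_le_mul_of_nonneg_right (hM _) (norm_nonneg _)
  · refine Tendsto.mul_const _ ((hf.tendsto x).comp ?_)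
    rw [tendsto_iff_norm_sub_tendsto_zero]
    refine squeeze_zero (fun _ => norm_nonneg _) (fun J => norm_node_sub_le J x y) ?_
    have := (tendsto_pow_atTop_nhds_zero_of_lt_one (r := (2 : ℝ)⁻¹) (by norm_num)
      (by norm_num)).mul_const (‖y‖ + √d)
    simpa [inv_pow] using this

/-- The energies of a continuous function with compact support converge to its squared norm. -/
theorem tendsto_levelEnergy {d : ℕ} {f φ : E d → ℂ} (hf : Continuous f)
    (hfc : HasCompactSupport f) (hφ : IsBoundedCompact φ) (hφ1 : ∫ x, φ x = 1) :
    Tendsto (levelEnergy f φ) atTop (𝓝 (∫⁻ x, ‖f x‖ₑ ^ 2)) := by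
  obtain ⟨M, hM⟩ := hf.bounded_above_of_compact_support hfc
  obtain ⟨R, hR⟩ := hfc.isCompact.isBounded.subset_closedBall 0
  obtain ⟨r, hr⟩ := hφ.compact.isCompact.isBounded.subset_closedBall 0
  -- If `φ y ≠ 0`, the node lies within `r + √d` of `x` for every `J`, so the average vanishes once
  -- `‖x‖ > R + (r + √d)`.
  have hb (J : ℕ) (x : E d) : ‖quasiInterpolant f φ J x‖ ≤
      (Metric.closedBall (0 : E d) (R + (r + √d))).indicator (fun _ => ∫ y, M * ‖φ y‖) x := by
    by_cases hx : x ∈ Metric.closedBall (0 : E d) (R + (r + √d))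
    · rw [Set.indicator_of_mem hx]
      refine norm_integral_le_of_norm_le (hφ.integrable.norm.const_mul M) (.of_forall fun y => ?_)
      rw [norm_mul, RCLike.norm_conj]
      exact mul_le_mul_of_nonneg_right (hM _) (norm_nonneg _)
    · rw [Set.indicator_of_notMem hx, quasiInterpolant, integral_eq_zero_of_ae, norm_zero]
      refine .of_forall fun y => ?_
      by_cases hy : φ y = 0
      · simp [hy]
      · have hyr : ‖y‖ ≤ r := mem_closedBall_zero_iff.1 (hr (subset_tsupport φ hy))
        have hf0 : f (((2 : ℝ) ^ J)⁻¹ • (y + pt (floorPt (((2 : ℝ) ^ J) • x)))) = 0 := by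
          by_contra h
          have h1 := mem_closedBall_zero_iff.1 (hR (subset_tsupport f h))
          have h2 := norm_node_sub_le J x y
          have h3 : ((2 : ℝ) ^ J)⁻¹ * (‖y‖ + √d) ≤ r + √d := by
            have : ((2 : ℝ) ^ J)⁻¹ ≤ 1 := inv_le_one_of_one_le₀ (one_le_pow₀ one_le_two)
            calc ((2 : ℝ) ^ J)⁻¹ * (‖y‖ + √d) ≤ 1 * (‖y‖ + √d) := by gcongr
              _ ≤ r + √d := by linarith
          refine hx (mem_closedBall_zero_iff.2 ?_)
          have h4 := norm_sub_norm_le x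
            (((2 : ℝ) ^ J)⁻¹ • (y + pt (floorPt (((2 : ℝ) ^ J) • x))))
          rw [norm_sub_rev] at h4
          linarith
        simp only [hf0, zero_mul, Pi.zero_apply]
  have hlevel : levelEnergy f φ = fun J => ∫⁻ x, ‖quasiInterpolant f φ J x‖ₑ ^ 2 :=
    funext (levelEnergy_eq_lintegral f φ)
  rw [hlevel]
  refine tendsto_lintegral_of_dominated_convergence
    ((Metric.closedBall (0 : E d) (R + (r + √d))).indicator
      fun _ => ENNReal.ofReal (∫ y, M * ‖φ y‖) ^ 2)
    (fun J => (measurable_quasiInterpolant f φ J).enorm.pow_const 2)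
    (fun J => .of_forall fun x => ?_) ?_ (.of_forall fun x => ?_)
  · have := hb J x
    by_cases hx : x ∈ Metric.closedBall (0 : E d) (R + (r + √d))
    · rw [Set.indicator_of_mem hx] at this ⊢
      simp only [← ofReal_norm]
      exact pow_le_pow_left' (ENNReal.ofReal_le_ofReal this) 2
    · rw [Set.indicator_of_notMem hx] at this ⊢
      simp [norm_le_zero_iff.1 this]
  · rw [lintegral_indicator_const Metric.isClosed_closedBall.measurableSet]
    exact ENNReal.mul_ne_top (by finiteness) measure_closedBall_lt_top.ne
  · exact (ENNReal.continuous_pow 2).tendsto _ |>.comp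
      ((tendsto_quasiInterpolant hf hfc hφ hφ1 x).enorm)

open Filter Topology

/-! ### The tight framelet -/

lemma inner_toLp_eq_pairing {d : ℕ} {f g : E d → ℂ} (hf : MemLp f 2) (hg : MemLp g 2) :
    inner ℂ (hg.toLp g) (hf.toLp f) = pairing f g := by
  rw [L2.inner_def, pairing]
  refine integral_congr_ae ?_
  filter_upwards [hf.coeFn_toLp, hg.coeFn_toLp] with x h1 h2
  rw [h1, h2, RCLike.inner_apply]

lemma enorm_toLp_sq {d : ℕ} {f : E d → ℂ} (hf : MemLp f 2) :
    ‖hf.toLp f‖ₑ ^ 2 = ∫⁻ x, ‖f x‖ₑ ^ 2 := by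
  rw [Lp.enorm_toLp, eLpNorm_eq_lintegral_rpow_enorm_toReal two_ne_zero ENNReal.ofNat_ne_top,
    ← ENNReal.rpow_natCast, ← ENNReal.rpow_mul]
  simp

/-- Monotone energies converge to the squared norm for every square-integrable function. -/
theorem tendsto_levelEnergy_of_monotone {d : ℕ} {φ : E d → ℂ} (hφ : IsBoundedCompact φ)
    (hφ1 : ∫ x, φ x = 1) (hmono : ∀ f, MemLp f 2 → Monotone (levelEnergy f φ)) {f : E d → ℂ}
    (hf : MemLp f 2) : Tendsto (levelEnergy f φ) atTop (𝓝 (∫⁻ x, ‖f x‖ₑ ^ 2)) := by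
  let v : ℕ → (Fin d → ℤ) → Lp ℂ 2 (volume : Measure (E d)) :=
    fun J k => ((hφ.atom J k).memLp 2).toLp (atom φ J k)
  have hv {f : E d → ℂ} (hf : MemLp f 2) :
      (fun J => ∑' k, ‖inner ℂ (v J k) (hf.toLp f)‖ₑ ^ 2) = levelEnergy f φ := by
    ext J
    exact tsum_congr fun k => by rw [inner_toLp_eq_pairing]
  let D : Set (Lp ℂ 2 (volume : Measure (E d))) :=
    {F | ∃ (f : E d → ℂ) (hf : MemLp f 2), Continuous f ∧ HasCompactSupport f ∧ hf.toLp f = F}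
  have hD : Dense D := by
    refine Metric.dense_iff.2 fun F r hr => ?_
    have hF := Lp.memLp F
    obtain ⟨g, hgc, hle, hg, hg2⟩ := hF.exists_hasCompactSupport_eLpNorm_sub_le
      ENNReal.ofNat_ne_top (ε := ENNReal.ofReal (r / 2)) (by simpa using hr)
    refine ⟨hg2.toLp g, ?_, g, hg2, hg, hgc, rfl⟩
    have h1 : hg2.toLp g - F = (hg2.sub hF).toLp (g - (F : E d → ℂ)) := by
      rw [MemLp.toLp_sub hg2 hF, Lp.toLp_coeFn]
    rw [Metric.mem_ball, dist_eq_norm, h1, Lp.norm_toLp, eLpNorm_sub_comm]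
    exact (ENNReal.toReal_le_of_le_ofReal (by positivity) hle).trans_lt (by linarith)
  have := tendsto_tsum_enorm_inner_of_dense v (fun F => ?_) hD ?_ (hf.toLp f)
  · rwa [hv, enorm_toLp_sq] at this
  · have h := hv (Lp.memLp F)
    rw [Lp.toLp_coeFn] at h
    rw [h]
    exact hmono _ (Lp.memLp F)
  · rintro F ⟨f, hf, hfc, hfs, rfl⟩
    rw [hv, enorm_toLp_sq]
    exact tendsto_levelEnergy hfc hfs hφ hφ1

/-- A bounded refinable function with compact support generates a tight framelet with the projected
Haar filters. -/
theorem isTightFramelet_subdivide {d n s : ℕ} (P : Matrix (Fin d) (Fin n) ℤ)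
    (hP : Set.MapsTo (fun k : Fin d → ℤ => Pᵀ *ᵥ k) (evenLattice d)ᶜ (evenLattice n)ᶜ)
    {e : Fin s → (Fin n → ℤ) × (Fin n → ℤ)} (he : IsEdgeEnumeration e) {φ : E d → ℂ}
    (hφ : IsBoundedCompact φ) (hφ1 : ∫ x, φ x = 1)
    (hφr : φ =ᵐ[volume] subdivide (project P (haarLowPass n)) φ) :
    IsTightFramelet φ fun l => subdivide (project P (haarHighPass (e l))) φ where
  memLp_phi := hφ.memLp 2
  memLp_psi l := (hφ.subdivide _).memLp 2
  norm_sq f hf := by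
    have hstep {f : E d → ℂ} (hf : MemLp f 2) := levelEnergy_succ P hP he hf hφ hφr
    have hmono (f : E d → ℂ) (hf : MemLp f 2) : Monotone (levelEnergy f φ) :=
      monotone_nat_of_le_succ fun j => by rw [hstep hf]; exact le_self_add
    have hsum (J : ℕ) : levelEnergy f φ J = levelEnergy f φ 0 + ∑ j ∈ Finset.range J,
        ∑ l, levelEnergy f (subdivide (project P (haarHighPass (e l))) φ) j := by
      induction J with
      | zero => simp
      | succ J ih => rw [hstep hf, ih, Finset.sum_range_succ, add_assoc]
    have h1 := tendsto_levelEnergy_of_monotone hφ hφ1 hmono hf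
    have h2 : Tendsto (levelEnergy f φ) atTop (𝓝 (levelEnergy f φ 0 + ∑' j,
        ∑ l, levelEnergy f (subdivide (project P (haarHighPass (e l))) φ) j)) := by
      refine ((ENNReal.tendsto_nat_tsum _).const_add _).congr fun J => (hsum J).symm
    rw [tendsto_nhds_unique h1 h2, levelEnergy_zero]
    rfl

end BoxSpline

theorem theorem2 (d n : ℕ) (P : Matrix (Fin d) (Fin n) ℤ)
    (hrank : (P.map (Int.cast : ℤ → ℝ)).rank = d)
    (hP : Set.MapsTo (fun k : Fin d → ℤ => Pᵀ *ᵥ k) (evenLattice d)ᶜ (evenLattice n)ᶜ)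
    (e : Fin ((2 ^ n).choose 2) → (Fin n → ℤ) × (Fin n → ℤ)) (he : IsEdgeEnumeration e) :
    -- the projected filters form a tight framelet filter bank
    IsTightFrameletFilterBank (project P (haarLowPass n))
      (fun l => project P (haarHighPass (e l))) ∧
    -- the projected low-pass filter is the refinement filter of the box spline
    (fourierSeries (project P (haarLowPass n)) 0 = 1 ∧
      ∀ ξ : E d, boxSplineHat P ((2 : ℝ) • ξ) =
        fourierSeries (project P (haarLowPass n)) ξ * boxSplineHat P ξ) ∧
    -- each high-pass filter has just two nonzero coefficients, of opposite signs, except that it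
    -- is zero when the two endpoints of the edge have the same projection
    (∀ l, (P *ᵥ (e l).1 ≠ P *ᵥ (e l).2 → IsDirectionalFilter (project P (haarHighPass (e l)))) ∧
      (P *ᵥ (e l).1 = P *ᵥ (e l).2 → project P (haarHighPass (e l)) = 0)) ∧
    -- the tempered distributions with the prescribed Fourier transforms exist
    (∀ ξ : E d, Multipliable fun j : ℕ =>
      fourierSeries (project P (haarLowPass n)) (((2 : ℝ) ^ (j + 1))⁻¹ • ξ)) ∧
    (∃ φ ψ, IsGeneratedBy (project P (haarLowPass n))
      (fun l => project P (haarHighPass (e l))) φ ψ) ∧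
    -- they are the box spline and compactly supported functions forming a tight framelet
    ∀ φ ψ, IsGeneratedBy (project P (haarLowPass n))
        (fun l => project P (haarHighPass (e l))) φ ψ →
      IsBoxSpline P φ ∧
      ∃ (φf : E d → ℂ) (ψf : Fin ((2 ^ n).choose 2) → E d → ℂ),
        IsRepresentedBy φ φf ∧ (∀ l, IsRepresentedBy (ψ l) (ψf l)) ∧
        HasCompactSupport φf ∧ (∀ l, HasCompactSupport (ψf l)) ∧
        IsTightFramelet φf ψf := by
  obtain ⟨g, hgm, ⟨C, hC⟩, hgc, hgF⟩ := exists_boxSpline P hrank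
  set φf : E d → ℂ := fun x => (g x : ℂ) with hφf
  have hφ : IsBoundedCompact φf := ⟨Complex.measurable_ofReal.comp hgm,
    ⟨C, fun x => by rw [hφf, Complex.norm_real]; exact hC x⟩,
    hgc.comp_left Complex.ofReal_zero⟩
  have hFφ : angularFourier φf = boxSplineHat P := funext hgF
  have hψ (l) : angularFourier (subdivide (project P (haarHighPass (e l))) φf) = fun ξ =>
      fourierSeries (project P (haarHighPass (e l))) ((2 : ℝ)⁻¹ • ξ) *
        refinableHat (project P (haarLowPass n)) ((2 : ℝ)⁻¹ • ξ) := by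
    ext ξ
    rw [angularFourier_subdivide _ hφ, hFφ, refinableHat_project_haarLowPass]
  -- The Fourier-side refinement equation at `ξ/2` and injectivity of the transform give the
  -- refinement equation for functions.
  have hφr : φf =ᵐ[volume] subdivide (project P (haarLowPass n)) φf := by
    refine ae_eq_of_angularFourier_eq hφ.integrable (hφ.subdivide _).integrable ?_
    ext ξ
    rw [angularFourier_subdivide _ hφ, hFφ, ← boxSplineHat_two_smul, smul_smul,
      mul_inv_cancel₀ two_ne_zero, one_smul]
  have hφ1 : ∫ x, φf x = 1 := by
    have h := congrFun hFφ 0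
    rw [boxSplineHat_zero] at h
    simpa [angularFourier] using h
  obtain ⟨T, hT, hT'⟩ := exists_temperedDistribution hφ.integrable
  choose S hS hS' using fun l => exists_temperedDistribution
    (hφ.subdivide (project P (haarHighPass (e l)))).integrable
  have hgen : IsGeneratedBy (project P (haarLowPass n))
      (fun l => project P (haarHighPass (e l))) T S :=
    ⟨by rwa [refinableHat_project_haarLowPass, ← hFφ], fun l => by rw [← hψ l]; exact hS' l⟩
  refine ⟨isTightFrameletFilterBank_project P hP he,
    ⟨fourierSeries_project_haarLowPass_zero P, boxSplineHat_two_smul P⟩,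
    fun l => ⟨isDirectionalFilter_project_haarHighPass P, project_haarHighPass_eq_zero P⟩,
    multipliable_fourierSeries_project_haarLowPass P, ⟨T, S, hgen⟩, fun φ ψ h => ⟨?_, ?_⟩⟩
  · rw [IsBoxSpline, ← refinableHat_project_haarLowPass]
    exact h.phi
  -- The prescribed transforms determine the distributions, so arbitrary generators coincide with
  -- the constructed ones.
  · obtain rfl : T = φ := hgen.phi.unique h.phi
    obtain rfl : S = ψ := funext fun l => (hgen.psi l).unique (h.psi l)
    exact ⟨φf, fun l => subdivide (project P (haarHighPass (e l))) φf, hT, hS, hφ.compact,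
      fun l => (hφ.subdivide _).compact, isTightFramelet_subdivide P hP he hφ hφ1 hφr⟩
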